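/- A compact polyhedron is a subset of a finite-dimensional real vector space that is the underlying set of a finite geometric simplicial complex (a triangulation of it). A map between polyhedra, with compact domain, is PL if it is affine on each simplex of some triangulation of its domain. A topological (resp. PL) embedding is a continuous (resp. PL) map that is a homeomorphism (resp. PL homeomorphism) onto its image. Let $f\colon N\to M$ be a non-degenerate PL map between compact polyhedra, i.e. a PL map such that no point-inverse $f^{-1}(y)$, $y\in M$, has positive dimension, and let $k\ge 0$ be an integer. Call $f$ a topological (resp. PL) $k$-prem if there is a map $g\colon N\to\mathbb R^k$ such that $f\times g\colon N\to M\times\mathbb R^k$, $x\mapsto (f(x),g(x))$, is a topological (resp. PL) embedding. A lift of $f$ is a map $e\colon N\to M\times\mathbb R^k$ whose composition with the projection $M\times\mathbb R^k\to M$ is $f$. Then: 1. $f$ is a topological $k$-prem if and only if it is a PL $k$-prem. 2. Every topological embedding $e\colon N\to M\times\mathbb R^k$ that lifts $f$ is isotopic through lifts of $f$ to a PL embedding; that is, there is a continuous map $H\colon [0,1]\times N\to M\times\mathbb R^k$ such that every $H_t=H(t,\cdot)$ is a topological embedding which lifts $f$, $H_0=e$, and $H_1$ is a PL embedding. 3.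 If moreover $N_0\subseteq N$ is a compact subpolyhedron and $e|_{N_0}$ is PL, then the isotopy in 2 may be chosen to keep $N_0$ fixed, i.e. $H_t(x)=e(x)$ for all $t\in[0,1]$ and $x\in N_0$. -/

import Mathlib

section PLTopology

variable {E F V : Type*}
  [NormedAddCommGroup E] [NormedSpace ℝ E]
  [NormedAddCommGroup F] [NormedSpace ℝ F]
  [NormedAddCommGroup V] [NormedSpace ℝ V]

/-- `K` is a (finite, geometric) triangulation of the set `P`. -/
def IsTriangulation (K : Geometry.SimplicialComplex ℝ E) (P : Set E) : Prop :=
  K.faces.Finite ∧ K.space = P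

/-- A compact polyhedron: the underlying set of a finite geometric simplicial complex. -/
def IsCompactPolyhedron (P : Set E) : Prop :=
  ∃ K : Geometry.SimplicialComplex ℝ E, IsTriangulation K P

/-- A map `h : P → V` from a compact polyhedron to a vector space is PL if it is affine on every
simplex of some triangulation of `P`. A map into a polyhedron `Q ⊆ V` is PL if it is PL as a map
into `V`. -/
def IsPL {P : Set E} (h : P → V) : Prop :=
  ∃ K : Geometry.SimplicialComplex ℝ E, IsTriangulation K P ∧
    ∀ s ∈ K.faces, ∃ A : E →ᵃ[ℝ] V, ∀ x : P, (x : E) ∈ convexHull ℝ (s : Set E) → h x = A x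

/-- A PL embedding: a PL map which is a PL homeomorphism onto its image, i.e. its inverse
`Set.range h → P` exists and is PL as well. -/
def IsPLEmbedding {P : Set E} (h : P → V) : Prop :=
  IsPL h ∧ ∃ r : Set.range h → P,
    IsPL (fun y => (r y : E)) ∧ Function.LeftInverse r (Set.rangeFactorization h)

/-- The dimension of a polyhedron `P`: the largest dimension of a simplex contained in `P`
(`⊥` if `P` is empty). -/
noncomputable def polyhedronDim (P : Set E) : WithBot ℕ∞ :=
  sSup ((fun n : ℕ => (n : WithBot ℕ∞)) ''
    {n | ∃ v : Fin (n + 1) → E, AffineIndependent ℝ v ∧ convexHull ℝ (Set.range v) ⊆ P})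

/-- No point-inverse of `f` has positive dimension. -/
def IsNondegenerate {N : Set E} {M : Set F} (f : N → M) : Prop :=
  ∀ y : M, ¬ 0 < polyhedronDim ((fun x : N => (x : E)) '' (f ⁻¹' {y}))

/-- The inclusion of `M × ℝᵏ` in the vector space `F × ℝᵏ`. -/
def prodIncl {M : Set F} {k : ℕ} (p : M × EuclideanSpace ℝ (Fin k)) :
    F × EuclideanSpace ℝ (Fin k) :=
  (p.1, p.2)

/-- `f` is a topological `k`-prem. -/
def IsTopologicalPrem {N : Set E} {M : Set F} (k : ℕ) (f : N → M) : Prop :=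
  ∃ g : N → EuclideanSpace ℝ (Fin k), Topology.IsEmbedding (fun x => (f x, g x))

/-- `f` is a PL `k`-prem. -/
def IsPLPrem {N : Set E} {M : Set F} (k : ℕ) (f : N → M) : Prop :=
  ∃ g : N → EuclideanSpace ℝ (Fin k), IsPLEmbedding (fun x => prodIncl (f x, g x))

/-- `e : N → M × ℝᵏ` lifts `f : N → M`. -/
def IsLift {N : Set E} {M : Set F} {k : ℕ} (f : N → M)
    (e : N → M × EuclideanSpace ℝ (Fin k)) : Prop :=
  ∀ x, (e x).1 = f x

/-- `e` is isotopic to `e'` through lifts of `f`, by an isotopy keeping `N₀` fixed. -/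
def IsotopicThroughLiftsRel {N : Set E} {M : Set F} {k : ℕ} (f : N → M) (N₀ : Set E)
    (e e' : N → M × EuclideanSpace ℝ (Fin k)) : Prop :=
  ∃ H : unitInterval × N → M × EuclideanSpace ℝ (Fin k),
    Continuous H ∧
    (∀ x, H (0, x) = e x) ∧
    (∀ x, H (1, x) = e' x) ∧
    (∀ t, Topology.IsEmbedding (fun x => H (t, x)) ∧ IsLift f (fun x => H (t, x))) ∧
    (∀ t, ∀ x : N, (x : E) ∈ N₀ → H (t, x) = e x)

end PLTopology

/-! Write the lift as (f, g). Interpolating g linearly on a triangulation of N gives a PL lift. The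
difficulty is injectivity on the fibres of f: sheets of N meet over M, and near their intersection a
fine mesh alone does not keep the images apart.

By non-degeneracy f is injective on every simplex δ of a triangulation on which it is affine. So g
becomes a family of maps G_δ = g ∘ (f|δ)⁻¹ on the convex sets f(δ), and injectivity of (f, g) says
that G_δ and G_δ' coincide only over f(δ ∩ δ'). Call {δ : y ∈ f(δ)} the type of y, and its
cardinality the rank. A triangulation of M is subdivided by bisecting edges until a point of a face
lies in f(δ) exactly when its supporting vertices do, types form a chain along each face, and the
following holds (`exists_isSeparated`): over a face with a vertex of maximal rank in f(δ) ∩ f(δ')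
but outside f(δ ∩ δ'), the images of G_δ and G_δ' have disjoint convex hulls. The last property is
achieved in descending order of rank: the chain condition excludes coincidences, compactness gives a
positive distance, and bisecting only edges with ends of rank at most n preserves what holds for
larger ranks.

Lifting to N (`exists_isOrderedLift`) and ordering vertices by decreasing rank, two lifts of a
simplex share an initial face, and g maps disjoint lifts into disjoint convex hulls. The isotopy
`straighten` lists the barycentric weights of x in this order, maps the first t units of mass
linearly, and sends the normalized remainder through g. Let x and x' lie in one fibre and have equal
images at time t. If some common vertex is not exhausted, the extracted parts agree and cancel, and
injectivity of (f, g) applies to the remainders. Otherwise the common part cancels, and what is left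
would lie in disjoint convex hulls (`straighten_injective`). Where g is affine on a face nothing
moves (`straighten_eq`), which gives the relative statement. -/

namespace PLLift

open scoped Classical
open Set

/-! ### Barycentric weights -/

section Weights

variable {E V : Type*} [AddCommGroup E] [Module ℝ E] [AddCommGroup V] [Module ℝ V]

/-- The linear combination of the values of `h` with coefficients `w`. -/
noncomputable abbrev lc (h : E → V) : (E →₀ ℝ) →ₗ[ℝ] V := Finsupp.linearCombination ℝ h

/-- Barycentric weights: nonnegative coefficients of total mass one. -/
structure IsWeight (w : E →₀ ℝ) : Prop where
  nonneg : ∀ v, 0 ≤ w v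
  mass : lc (fun _ => (1 : ℝ)) w = 1

omit [AddCommGroup E] [Module ℝ E] in
theorem lc_eq_sum {w : E →₀ ℝ} {s : Finset E} (hs : w.support ⊆ s) (h : E → V) :
    lc h w = ∑ v ∈ s, w v • h v := by
  rw [Finsupp.linearCombination_apply, Finsupp.sum_of_support_subset _ hs _ (by simp)]

omit [AddCommGroup E] [Module ℝ E] in
theorem lc_congr {w : E →₀ ℝ} {h h' : E → V} (hh : ∀ v ∈ w.support, h v = h' v) :
    lc h w = lc h' w := by
  rw [lc_eq_sum subset_rfl, lc_eq_sum subset_rfl]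
  exact Finset.sum_congr rfl fun v hv => by rw [hh v hv]

omit [AddCommGroup E] [Module ℝ E] in
theorem IsWeight.support_nonempty {w : E →₀ ℝ} (hw : IsWeight w) : w.support.Nonempty := by
  by_contra h
  have h0 : w = 0 := by simpa using h
  have := hw.mass
  simp [h0] at this

omit [AddCommGroup E] [Module ℝ E] in
theorem IsWeight.pos {w : E →₀ ℝ} (hw : IsWeight w) {v : E} (hv : v ∈ w.support) : 0 < w v :=
  lt_of_le_of_ne (hw.nonneg v) (Ne.symm (Finsupp.mem_support_iff.1 hv))

omit [AddCommGroup E] [Module ℝ E] in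
theorem isWeight_single (v : E) : IsWeight (Finsupp.single v (1 : ℝ)) :=
  ⟨fun u => by rw [Finsupp.single_apply]; split_ifs <;> norm_num, by simp⟩

omit [AddCommGroup E] [Module ℝ E] in
theorem IsWeight.lc_mem_convexHull {w : E →₀ ℝ} (hw : IsWeight w) {s : Finset E}
    (hs : w.support ⊆ s) (h : E → V) : lc h w ∈ convexHull ℝ (h '' (s : Set E)) := by
  rw [lc_eq_sum hs]
  refine (convex_convexHull ℝ _).sum_mem (fun v _ => hw.nonneg v) ?_ fun v hv =>
    subset_convexHull ℝ _ ⟨v, hv, rfl⟩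
  have := hw.mass
  rw [lc_eq_sum hs] at this
  simpa using this

theorem mem_convexHull_iff_weight {s : Finset E} {x : E} :
    x ∈ convexHull ℝ (s : Set E) ↔ ∃ w : E →₀ ℝ, IsWeight w ∧ w.support ⊆ s ∧ lc id w = x := by
  constructor
  · rw [Finset.mem_convexHull']
    rintro ⟨c, h0, h1, hx⟩
    have hsup : (Finsupp.onFinset s (fun v => if v ∈ s then c v else 0)
        (fun v hv => by by_contra h; simp [h] at hv)).support ⊆ s :=
      Finsupp.support_onFinset_subset
    refine ⟨_, ⟨fun v => ?_, ?_⟩, hsup, ?_⟩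
    · simp only [Finsupp.onFinset_apply]
      split_ifs with h
      exacts [h0 v h, le_rfl]
    · rw [lc_eq_sum hsup]
      refine (Finset.sum_congr rfl fun v hv => ?_).trans h1
      simp [hv]
    · rw [lc_eq_sum hsup, ← hx]
      exact Finset.sum_congr rfl fun v hv => by simp [hv]
  · rintro ⟨w, hw, hs, rfl⟩
    simpa using hw.lc_mem_convexHull hs id

theorem affineMap_lc (A : E →ᵃ[ℝ] V) {w : E →₀ ℝ} (hw : lc (fun _ => (1 : ℝ)) w = 1) :
    A (lc id w) = lc A w := by
  have hA : ∀ x, A x = A.linear x + A 0 := fun x => by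
    have := A.map_vadd 0 x
    simpa using this
  rw [hA, lc_eq_sum subset_rfl, lc_eq_sum subset_rfl]
  rw [lc_eq_sum subset_rfl] at hw
  simp only [smul_eq_mul, mul_one] at hw
  have : ∑ v ∈ w.support, w v • A v = ∑ v ∈ w.support, w v • A.linear v
      + (∑ v ∈ w.support, w v) • A 0 := by
    rw [Finset.sum_smul, ← Finset.sum_add_distrib]
    exact Finset.sum_congr rfl fun v _ => by rw [hA v, smul_add]
  rw [this, hw]
  simp

omit [AddCommGroup E] [Module ℝ E] in
theorem lc_mapDomain {W : Type*} (f : E → W) (h : W → V) (w : E →₀ ℝ) :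
    lc h (w.mapDomain f) = lc (h ∘ f) w := by
  simp only [lc, Finsupp.linearCombination_mapDomain]

omit [AddCommGroup E] [Module ℝ E] in
theorem IsWeight.mapDomain {W : Type*} {w : E →₀ ℝ} (hw : IsWeight w) (f : E → W) :
    IsWeight (w.mapDomain f) := by
  constructor
  · intro v
    rw [Finsupp.mapDomain, Finsupp.sum, Finsupp.finsetSum_apply]
    refine Finset.sum_nonneg fun u _ => ?_
    rw [Finsupp.single_apply]
    split_ifs
    exacts [hw.nonneg u, le_rfl]
  · have := lc_mapDomain f (fun _ : W => (1 : ℝ)) w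
    rw [this]
    exact hw.mass

omit [AddCommGroup E] [Module ℝ E] in
-- Weights are nonnegative, so masses pushed to the same point cannot cancel.
theorem IsWeight.support_mapDomain {W : Type*} {w : E →₀ ℝ} (hw : IsWeight w) (f : E → W) :
    (w.mapDomain f).support = w.support.image f := by
  apply subset_antisymm Finsupp.mapDomain_support
  intro y hy
  obtain ⟨u, hu, rfl⟩ := Finset.mem_image.1 hy
  rw [Finsupp.mem_support_iff, Finsupp.mapDomain, Finsupp.sum, Finsupp.finsetSum_apply]
  refine ne_of_gt (Finset.sum_pos' (fun v _ => ?_) ⟨u, hu, ?_⟩)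
  · rw [Finsupp.single_apply]
    split_ifs
    exacts [hw.nonneg v, le_rfl]
  · simpa using hw.pos hu

end Weights

/-! ### Simplicial complexes via uniqueness of weights -/

section Complexes

variable {E V : Type*} [AddCommGroup E] [Module ℝ E] [AddCommGroup V] [Module ℝ V]

/-- A finite simplicial complex, given by its faces (including the empty one): the faces form a
lower set, and every point has at most one system of barycentric weights carried by a face. -/
structure IsComplex (S : Finset (Finset E)) : Prop where
  down : ∀ s ∈ S, ∀ t ⊆ s, t ∈ S
  uniq : ∀ w w' : E →₀ ℝ, IsWeight w → IsWeight w' → w.support ∈ S → w'.support ∈ S →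
    lc id w = lc id w' → w = w'

/-- The underlying set of a complex. -/
def space (S : Finset (Finset E)) : Set E :=
  {x | ∃ w : E →₀ ℝ, IsWeight w ∧ w.support ∈ S ∧ lc id w = x}

theorem IsComplex.mem_space_iff {S : Finset (Finset E)} (hS : IsComplex S) {x : E} :
    x ∈ space S ↔ ∃ s ∈ S, x ∈ convexHull ℝ (s : Set E) := by
  constructor
  · rintro ⟨w, hw, hs, rfl⟩
    exact ⟨_, hs, mem_convexHull_iff_weight.2 ⟨w, hw, subset_rfl, rfl⟩⟩
  · rintro ⟨s, hs, hx⟩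
    obtain ⟨w, hw, hws, rfl⟩ := mem_convexHull_iff_weight.1 hx
    exact ⟨w, hw, hS.down s hs _ hws, rfl⟩

theorem IsComplex.support_subset {S : Finset (Finset E)} (hS : IsComplex S) {w : E →₀ ℝ}
    (hw : IsWeight w) (hwS : w.support ∈ S) {s : Finset E} (hs : s ∈ S)
    (hx : lc id w ∈ convexHull ℝ (s : Set E)) : w.support ⊆ s := by
  obtain ⟨w', hw', hws, he⟩ := mem_convexHull_iff_weight.1 hx
  rw [hS.uniq w w' hw hw' hwS (hS.down s hs _ hws) he.symm]
  exact hws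

theorem IsComplex.convexHull_inter {S : Finset (Finset E)} (hS : IsComplex S) {s t : Finset E}
    (hs : s ∈ S) (ht : t ∈ S) {x : E} (hxs : x ∈ convexHull ℝ (s : Set E))
    (hxt : x ∈ convexHull ℝ (t : Set E)) : x ∈ convexHull ℝ ((s ∩ t : Finset E) : Set E) := by
  obtain ⟨w, hw, hws, rfl⟩ := mem_convexHull_iff_weight.1 hxs
  exact mem_convexHull_iff_weight.2 ⟨w, hw, Finset.subset_inter hws
    (hS.support_subset hw (hS.down s hs _ hws) ht hxt), rfl⟩

/-- An affine relation `c` among the vertices allows the weights `1 / n` of the barycentre to be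
changed to `1 / n + ε * c v` without moving the point. Uniqueness of weights then forces `c = 0`. -/
theorem IsComplex.affineIndependent {S : Finset (Finset E)} (hS : IsComplex S) {s : Finset E}
    (hs : s ∈ S) : AffineIndependent ℝ ((↑) : s → E) := by
  rw [affineIndependent_iff_of_fintype]
  intro c hc hx
  rw [Finset.weightedVSub_eq_linear_combination _ hc] at hx
  rcases s.eq_empty_or_nonempty with rfl | hne
  · exact fun i => absurd i.2 (Finset.notMem_empty _)
  set n : ℝ := (s.card : ℝ) with hn
  have hnpos : 0 < n := by rw [hn]; exact_mod_cast hne.card_pos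
  set C : ℝ := ∑ v, |c v| with hC
  have hC0 : 0 ≤ C := Finset.sum_nonneg fun v _ => abs_nonneg _
  have hcC : ∀ v, |c v| ≤ C := fun v =>
    Finset.single_le_sum (f := fun v => |c v|) (fun v _ => abs_nonneg _) (Finset.mem_univ v)
  -- Chosen so that `ε * |c v| ≤ 1 / n`, which keeps the perturbed weights nonnegative.
  set ε : ℝ := 1 / (n * (1 + C)) with hε
  have hεpos : 0 < ε := by positivity
  have hεC : ε * C ≤ 1 / n := by
    rw [hε, div_mul_eq_mul_div, div_le_div_iff₀ (by positivity) hnpos]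
    nlinarith
  let g : ℝ → E →₀ ℝ := fun δ => Finsupp.onFinset s
    (fun v => if h : v ∈ s then 1 / n + δ * c ⟨v, h⟩ else 0)
    (fun v hv => by by_contra h; simp [h] at hv)
  have hgs : ∀ δ, (g δ).support ⊆ s := fun δ => Finsupp.support_onFinset_subset
  have hgv : ∀ δ (v : s), g δ v = 1 / n + δ * c v := fun δ v => by simp [g]
  have hlc : ∀ δ {W : Type _} [AddCommGroup W] [Module ℝ W] (h : E → W),
      lc h (g δ) = ∑ v : s, (1 / n) • h v + δ • ∑ v : s, c v • h v := by
    intro δ W _ _ h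
    rw [lc_eq_sum (hgs δ), ← Finset.sum_coe_sort s, Finset.smul_sum, ← Finset.sum_add_distrib]
    exact Finset.sum_congr rfl fun v _ => by rw [hgv, add_smul, mul_smul]
  have hw : ∀ δ, |δ| ≤ ε → IsWeight (g δ) := by
    intro δ hδ
    constructor
    · intro v
      by_cases hv : v ∈ s
      · rw [show g δ v = _ from hgv δ ⟨v, hv⟩]
        have h1 : |δ * c ⟨v, hv⟩| ≤ ε * C := by
          rw [abs_mul]
          exact mul_le_mul hδ (hcC _) (abs_nonneg _) hεpos.le
        have := neg_abs_le (δ * c ⟨v, hv⟩)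
        linarith
      · simp [g, hv]
    · rw [lc_eq_sum (hgs δ), ← Finset.sum_coe_sort s]
      simp only [hgv, smul_eq_mul, mul_one]
      rw [Finset.sum_add_distrib, ← Finset.mul_sum, hc]
      simp only [Finset.sum_const, Finset.card_univ, Fintype.card_coe, nsmul_eq_mul, mul_zero,
        add_zero]
      rw [← hn]
      field_simp
  have hS0 : ∀ δ, (g δ).support ∈ S := fun δ => hS.down s hs _ (hgs δ)
  have hg0 : g ε = g 0 := by
    refine hS.uniq _ _ (hw ε (abs_of_pos hεpos).le) (hw 0 (by simpa using hεpos.le)) (hS0 _)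
      (hS0 _) ?_
    rw [hlc, hlc]
    simp only [id]
    rw [hx]
    simp
  intro v
  have := DFunLike.congr_fun hg0 (v : E)
  rw [hgv, hgv] at this
  have h2 : ε * c v = 0 := by linarith
  rcases mul_eq_zero.1 h2 with h | h
  · exact absurd h hεpos.ne'
  · exact h

/-- The geometric simplicial complex with the nonempty faces of a complex. -/
def IsComplex.toSimplicialComplex {S : Finset (Finset E)} (hS : IsComplex S) :
    Geometry.SimplicialComplex ℝ E :=
  Geometry.SimplicialComplex.ofErase (S : Set (Finset E)) (fun _ hs => hS.affineIndependent hs)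
    (fun s t hts hs => hS.down s hs t hts)
    (fun s hs t ht x hx => by simpa using hS.convexHull_inter hs ht hx.1 hx.2)

theorem eq_of_affineIndependent {s : Finset E} (hs : AffineIndependent ℝ ((↑) : s → E))
    {w w' : E →₀ ℝ} (hw : IsWeight w) (hw' : IsWeight w') (h : w.support ⊆ s)
    (h' : w'.support ⊆ s) (he : lc id w = lc id w') : w = w' := by
  have h0 := affineIndependent_iff.1 hs Finset.univ (fun v => w v - w' v)
  have e1 := hw.mass
  have e2 := hw'.mass
  rw [lc_eq_sum h, ← Finset.sum_coe_sort s] at e1 he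
  rw [lc_eq_sum h', ← Finset.sum_coe_sort s] at e2 he
  have h1 := h0 (by simp only [Finset.sum_sub_distrib]; simp at e1 e2; simp [e1, e2])
    (by simp only [sub_smul, Finset.sum_sub_distrib]; exact sub_eq_zero.2 he)
  ext v
  by_cases hv : v ∈ s
  · have := h1 ⟨v, hv⟩ (Finset.mem_univ _)
    exact sub_eq_zero.1 this
  · rw [Finsupp.notMem_support_iff.1 (fun hh => hv (h hh)),
      Finsupp.notMem_support_iff.1 (fun hh => hv (h' hh))]

/-- A point carried by two faces also has weights on their intersection. Affine independence of
either face identifies these with both given systems. -/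
theorem exists_isComplex (K : Geometry.SimplicialComplex ℝ E) (hK : K.faces.Finite) :
    ∃ S : Finset (Finset E), IsComplex S ∧ (∀ s, s ∈ S ↔ s = ∅ ∨ s ∈ K.faces) ∧
      space S = K.space := by
  have hmem : ∀ s, s ∈ insert ∅ hK.toFinset ↔ s = ∅ ∨ s ∈ K.faces := by simp
  have hC : IsComplex (insert ∅ hK.toFinset) := by
    constructor
    · intro s hs t hts
      rw [hmem] at hs ⊢
      rcases t.eq_empty_or_nonempty with rfl | ht
      · exact Or.inl rfl
      rcases hs with rfl | hs
      · exact absurd (Finset.subset_empty.1 hts) ht.ne_empty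
      · exact Or.inr (K.down_closed hs hts ht)
    · intro w w' hw hw' hs hs' he
      have h1 := ((hmem _).1 hs).resolve_left hw.support_nonempty.ne_empty
      have h2 := ((hmem _).1 hs').resolve_left hw'.support_nonempty.ne_empty
      have hx : lc id w ∈ convexHull ℝ ((w.support ∩ w'.support : Finset E) : Set E) := by
        rw [Finset.coe_inter]
        refine K.inter_subset_convexHull h1 h2 ⟨?_, ?_⟩
        · exact mem_convexHull_iff_weight.2 ⟨w, hw, subset_rfl, rfl⟩
        · exact mem_convexHull_iff_weight.2 ⟨w', hw', subset_rfl, he.symm⟩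
      obtain ⟨u, hu, hus, hux⟩ := mem_convexHull_iff_weight.1 hx
      rw [← eq_of_affineIndependent (K.indep h1) hu hw (hus.trans Finset.inter_subset_left)
        subset_rfl hux]
      exact eq_of_affineIndependent (K.indep h2) hu hw' (hus.trans Finset.inter_subset_right)
        subset_rfl (hux.trans he)
  refine ⟨_, hC, hmem, ?_⟩
  ext x
  rw [hC.mem_space_iff, K.mem_space_iff]
  constructor
  · rintro ⟨s, hs, hx⟩
    rcases (hmem s).1 hs with rfl | hs
    · simp at hx
    · exact ⟨s, hs, hx⟩
  · rintro ⟨s, hs, hx⟩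
    exact ⟨s, (hmem s).2 (Or.inr hs), hx⟩

theorem IsComplex.isTriangulation {E : Type*} [NormedAddCommGroup E] [NormedSpace ℝ E]
    {S : Finset (Finset E)} (hS : IsComplex S) :
    IsTriangulation hS.toSimplicialComplex (space S) := by
  refine ⟨S.finite_toSet.subset fun s hs => hs.1, ?_⟩
  ext x
  rw [hS.mem_space_iff, Geometry.SimplicialComplex.mem_space_iff]
  constructor
  · rintro ⟨s, hs, hx⟩
    exact ⟨s, hs.1, hx⟩
  · rintro ⟨s, hs, hx⟩
    refine ⟨s, ⟨hs, ?_⟩, hx⟩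
    rintro rfl
    simp at hx

end Complexes

/-! ### Subdivision by bisecting edges -/

section Bisection

variable {E : Type*} [AddCommGroup E] [Module ℝ E]

/-- The subdivision of `S` by the new vertex `m` on the edge from `a` to `b`. -/
noncomputable def bisect (S : Finset (Finset E)) (a b m : E) : Finset (Finset E) :=
  S.filter (fun s => ¬(a ∈ s ∧ b ∈ s)) ∪
    (S.filter (fun t => ¬(a ∈ t ∧ b ∈ t) ∧ insert a (insert b t) ∈ S)).image (insert m)

omit [AddCommGroup E] [Module ℝ E] in
theorem mem_bisect {S : Finset (Finset E)} {a b m : E} {s : Finset E} :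
    s ∈ bisect S a b m ↔ (s ∈ S ∧ ¬(a ∈ s ∧ b ∈ s)) ∨
      ∃ t ∈ S, ¬(a ∈ t ∧ b ∈ t) ∧ insert a (insert b t) ∈ S ∧ insert m t = s := by
  simp only [bisect, Finset.mem_union, Finset.mem_filter, Finset.mem_image]
  constructor
  · rintro (h | ⟨t, ⟨h1, h2, h3⟩, h4⟩)
    exacts [Or.inl h, Or.inr ⟨t, h1, h2, h3, h4⟩]
  · rintro (h | ⟨t, h1, h2, h3, h4⟩)
    exacts [Or.inl h, Or.inr ⟨t, ⟨h1, h2, h3⟩, h4⟩]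

omit [AddCommGroup E] [Module ℝ E] in
theorem not_mem_and_mem_of_mem_bisect {S : Finset (Finset E)} {a b m : E} (hma : m ≠ a)
    (hmb : m ≠ b) {s : Finset E} (hs : s ∈ bisect S a b m) : ¬(a ∈ s ∧ b ∈ s) := by
  rcases mem_bisect.1 hs with h | ⟨t, _, h, _, rfl⟩
  · exact h.2
  · rintro ⟨h1, h2⟩
    exact h ⟨(Finset.mem_insert.1 h1).resolve_left hma.symm,
      (Finset.mem_insert.1 h2).resolve_left hmb.symm⟩

/-- Distribute the weight of `m` on `a` and `b`. -/
noncomputable def unbisect (a b m : E) (r : ℝ) (w : E →₀ ℝ) : E →₀ ℝ :=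
  w - Finsupp.single m (w m) + Finsupp.single a ((1 - r) * w m) + Finsupp.single b (r * w m)

omit [AddCommGroup E] [Module ℝ E] in
theorem lc_unbisect {V : Type*} [AddCommGroup V] [Module ℝ V] (h : E → V) (a b m : E) (r : ℝ)
    (hm : h m = (1 - r) • h a + r • h b) (w : E →₀ ℝ) : lc h (unbisect a b m r w) = lc h w := by
  simp only [unbisect, map_add, map_sub, lc, Finsupp.linearCombination_single, hm]
  module

/-- Weights on the two complexes correspond under `unbisect`, which does not move the point. No new
face contains both `a` and `b`, so the mass at `m` can be recovered as the largest amount that can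
be taken from `a` and `b` in the ratio `(1 - r) : r`. -/
theorem IsComplex.bisect {S : Finset (Finset E)} (hS : IsComplex S) {a b m : E}
    (hab : a ≠ b) (habS : {a, b} ∈ S) {r : ℝ} (hr0 : 0 < r) (hr1 : r < 1)
    (hm : m = (1 - r) • a + r • b) :
    IsComplex (bisect S a b m) ∧ space (bisect S a b m) = space S := by
  have hmo : m ∈ openSegment ℝ a b := ⟨1 - r, r, by linarith, hr0, by ring, hm.symm⟩
  have hma : m ≠ a := fun h => hab (left_mem_openSegment_iff.1 (h ▸ hmo))
  have hmb : m ≠ b := fun h => hab (right_mem_openSegment_iff.1 (h ▸ hmo))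
  have hvm : ∀ w : E →₀ ℝ, ∀ v, unbisect a b m r w v =
      (if v = m then 0 else w v) + (if v = a then (1 - r) * w m else 0) +
        (if v = b then r * w m else 0) := by
    intro w v
    simp only [unbisect, Finsupp.add_apply, Finsupp.sub_apply, Finsupp.single_apply]
    by_cases h1 : v = m
    · subst h1; simp [eq_comm]
    · simp [h1, Ne.symm h1, eq_comm]
  -- Were `m` a vertex of `S`, its unit weight would have to be carried by `{a, b}`, although `m` is
  -- neither end.
  have hmS : ∀ s ∈ S, m ∉ s := by
    intro s hs hms
    have h1 : (Finsupp.single m (1 : ℝ)).support ∈ S :=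
      hS.down s hs _ (Finsupp.support_single_subset.trans (by simpa using hms))
    have hsub := hS.support_subset (isWeight_single m) h1 habS (by
      simp only [Finsupp.linearCombination_single, id, one_smul]
      rw [hm]
      refine (convex_convexHull ℝ _) (subset_convexHull ℝ _ (by simp))
        (subset_convexHull ℝ _ (by simp)) (by linarith) hr0.le (by ring))
    have : m ∈ ({a, b} : Finset E) := hsub (by simp)
    simp [hma, hmb] at this
  have hwt : ∀ w : E →₀ ℝ, IsWeight w → IsWeight (unbisect a b m r w) := by
    intro w hw
    refine ⟨fun v => ?_, ?_⟩
    · rw [hvm]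
      have h1 := hw.nonneg v
      have h2 := mul_nonneg (sub_nonneg.2 hr1.le) (hw.nonneg m)
      have h3 := mul_nonneg hr0.le (hw.nonneg m)
      split_ifs <;> linarith
    · rw [lc_unbisect _ _ _ _ _ (by simp)]
      exact hw.mass
  have hsupp : ∀ w : E →₀ ℝ, w.support ∈ PLLift.bisect S a b m →
      (unbisect a b m r w).support ∈ S := by
    intro w hw
    rcases mem_bisect.1 hw with h | ⟨t, htS, h, htab, he⟩
    · have hwm : w m = 0 := Finsupp.notMem_support_iff.1 (hmS _ h.1)
      simpa [unbisect, hwm] using h.1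
    · refine hS.down _ htab _ fun v hv => ?_
      rw [Finsupp.mem_support_iff, hvm] at hv
      by_contra hv'
      simp only [Finset.mem_insert, not_or] at hv'
      rw [if_neg hv'.1, if_neg hv'.2.1] at hv
      by_cases hvm' : v = m
      · simp [hvm'] at hv
      · have : v ∉ w.support := by
          rw [← he]; simp [hvm', hv'.2.2]
        simp [hvm', Finsupp.notMem_support_iff.1 this] at hv
  have hlc : ∀ w : E →₀ ℝ, lc id (unbisect a b m r w) = lc id w := fun w =>
    lc_unbisect id a b m r (by simpa using hm) w
  refine ⟨⟨?_, ?_⟩, ?_⟩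
  · intro s hs t hts
    rcases mem_bisect.1 hs with h | ⟨u, huS, h, huab, rfl⟩
    · exact mem_bisect.2 (Or.inl ⟨hS.down s h.1 t hts, fun hh => h.2 ⟨hts hh.1, hts hh.2⟩⟩)
    · by_cases hmt : m ∈ t
      · have hu : t.erase m ⊆ u := by
          intro v hv
          exact (Finset.mem_insert.1 (hts (Finset.mem_of_mem_erase hv))).resolve_left
            (Finset.ne_of_mem_erase hv)
        refine mem_bisect.2 (Or.inr ⟨t.erase m, hS.down u huS _ hu,
          fun hh => h ⟨hu hh.1, hu hh.2⟩, ?_, Finset.insert_erase hmt⟩)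
        exact hS.down _ huab _ (Finset.insert_subset_insert _ (Finset.insert_subset_insert _ hu))
      · have hu : t ⊆ u := fun v hv => (Finset.mem_insert.1 (hts hv)).resolve_left
          (fun hh => hmt (hh ▸ hv))
        exact mem_bisect.2 (Or.inl ⟨hS.down u huS t hu, fun hh => h ⟨hu hh.1, hu hh.2⟩⟩)
  · have key : ∀ w w' : E →₀ ℝ, IsWeight w → IsWeight w' → w'.support ∈ PLLift.bisect S a b m →
        unbisect a b m r w = unbisect a b m r w' → w m ≤ w' m := by
      intro w w' hw hw' hs' he
      by_contra! hlt
      have ha := DFunLike.congr_fun he a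
      have hb := DFunLike.congr_fun he b
      rw [hvm, hvm] at ha hb
      simp only [hma.symm, hmb.symm, hab, hab.symm, if_true, if_false, add_zero] at ha hb
      have h1 := hw.nonneg a
      have h2 := hw.nonneg b
      refine not_mem_and_mem_of_mem_bisect hma hmb hs' ⟨?_, ?_⟩ <;>
        rw [Finsupp.mem_support_iff] <;> intro h0
      · nlinarith
      · nlinarith
    intro w w' hw hw' hs hs' he
    have heq : unbisect a b m r w = unbisect a b m r w' :=
      hS.uniq _ _ (hwt w hw) (hwt w' hw') (hsupp w hs) (hsupp w' hs') (by rw [hlc, hlc, he])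
    have hmm := le_antisymm (key w w' hw hw' hs' heq) (key w' w hw' hw hs heq.symm)
    ext v
    by_cases hv : v = m
    · rw [hv, hmm]
    · have := DFunLike.congr_fun heq v
      rw [hvm, hvm, if_neg hv, if_neg hv, hmm] at this
      linarith
  · ext x
    constructor
    · rintro ⟨w, hw, hs, rfl⟩
      exact ⟨_, hwt w hw, hsupp w hs, hlc w⟩
    · rintro ⟨w, hw, hs, rfl⟩
      by_cases hnot : ¬(a ∈ w.support ∧ b ∈ w.support)
      · exact ⟨w, hw, mem_bisect.2 (Or.inl ⟨hs, hnot⟩), rfl⟩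
      push Not at hnot
      -- The largest mass that can be moved to `m`; moving it exhausts `a` or `b`.
      set c := min (w a / (1 - r)) (w b / r) with hc
      have hr1' : 0 < 1 - r := by linarith
      have hca : (1 - r) * c ≤ w a := by
        have := min_le_left (w a / (1 - r)) (w b / r)
        rw [← hc, le_div_iff₀ hr1'] at this
        linarith
      have hcb : r * c ≤ w b := by
        have := min_le_right (w a / (1 - r)) (w b / r)
        rw [← hc, le_div_iff₀ hr0] at this
        linarith
      have hc0 : 0 ≤ c := le_min (div_nonneg (hw.nonneg _) hr1'.le) (div_nonneg (hw.nonneg _) hr0.le)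
      have heq : (1 - r) * c = w a ∨ r * c = w b := by
        rcases min_choice (w a / (1 - r)) (w b / r) with h | h
        · left; rw [hc, h]; field_simp
        · right; rw [hc, h]; field_simp
      set w' : E →₀ ℝ := w - Finsupp.single a ((1 - r) * c) - Finsupp.single b (r * c)
        + Finsupp.single m c with hw'
      have hwm : w m = 0 := Finsupp.notMem_support_iff.1 (hmS _ hs)
      have hv' : ∀ v, w' v = w v - (if v = a then (1 - r) * c else 0)
          - (if v = b then r * c else 0) + (if v = m then c else 0) := by
        intro v
        simp only [hw', Finsupp.add_apply, Finsupp.sub_apply, Finsupp.single_apply]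
        simp only [eq_comm]
      refine ⟨w', ⟨fun v => ?_, ?_⟩, ?_, ?_⟩
      · rw [hv']
        by_cases h1 : v = a
        · subst h1; simp [hab, hma.symm, hca]
        by_cases h2 : v = b
        · subst h2; simp [hab.symm, hmb.symm, hcb]
        by_cases h3 : v = m
        · subst h3; simp [hma, hmb, hwm, hc0]
        · simp [h1, h2, h3, hw.nonneg v]
      · have := hw.mass
        simp only [hw', map_add, map_sub, lc, Finsupp.linearCombination_single, smul_eq_mul,
          mul_one] at this ⊢
        linarith
      · have hsub : ∀ v ∈ w'.support, v = m ∨ v ∈ w.support := by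
          intro v hv
          by_cases h3 : v = m
          · exact Or.inl h3
          refine Or.inr ?_
          by_cases h1 : v = a
          · exact h1 ▸ hnot.1
          by_cases h2 : v = b
          · exact h2 ▸ hnot.2
          rw [Finsupp.mem_support_iff, hv'] at hv
          simpa [h1, h2, h3] using hv
        have hpos : m ∈ w'.support := by
          rw [Finsupp.mem_support_iff, hv']
          have hcpos : 0 < c := lt_min (div_pos (hw.pos hnot.1) hr1') (div_pos (hw.pos hnot.2) hr0)
          simp [hma, hmb, hwm, hcpos.ne']
        have hsub' : w'.support.erase m ⊆ w.support := fun v hv =>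
          ((hsub v (Finset.mem_of_mem_erase hv)).resolve_left (Finset.ne_of_mem_erase hv))
        refine mem_bisect.2 (Or.inr ⟨w'.support.erase m, hS.down _ hs _ hsub', ?_, ?_,
          Finset.insert_erase hpos⟩)
        · rintro ⟨h1, h2⟩
          have h1 := Finsupp.mem_support_iff.1 (Finset.mem_of_mem_erase h1)
          have h2 := Finsupp.mem_support_iff.1 (Finset.mem_of_mem_erase h2)
          rw [hv'] at h1 h2
          simp only [hma.symm, hmb.symm, hab, hab.symm, if_true, if_false, sub_zero,
            add_zero] at h1 h2
          rcases heq with h | h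
          · exact h1 (by linarith)
          · exact h2 (by linarith)
        · refine hS.down _ hs _ ?_
          simp only [Finset.insert_subset_iff]
          exact ⟨hnot.1, hnot.2, hsub'⟩
      · simp only [hw', map_add, map_sub, lc, Finsupp.linearCombination_single, id]
        rw [hm]
        module

/-- `S'` subdivides `S`, and for all `n' ≥ n` the faces of `S'` with vertices of rank at most `n'`
lie in such faces of `S`. -/
structure Refines (r : E → ℕ) (n : ℕ) (S' S : Finset (Finset E)) : Prop where
  space_eq : space S' = space S
  exists_face : ∀ n', n ≤ n' → ∀ s' ∈ S', (∀ v ∈ s', r v ≤ n') →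
    ∃ s ∈ S, (∀ v ∈ s, r v ≤ n') ∧ convexHull ℝ (s' : Set E) ⊆ convexHull ℝ (s : Set E)

theorem Refines.refl (r : E → ℕ) (n : ℕ) (S : Finset (Finset E)) : Refines r n S S :=
  ⟨rfl, fun _ _ s hs hr => ⟨s, hs, hr, subset_rfl⟩⟩

theorem Refines.trans {r : E → ℕ} {n : ℕ} {S S' S'' : Finset (Finset E)}
    (h : Refines r n S'' S') (h' : Refines r n S' S) : Refines r n S'' S := by
  refine ⟨h.space_eq.trans h'.space_eq, fun n' hn s hs hr => ?_⟩
  obtain ⟨s', hs', hr', hc⟩ := h.exists_face n' hn s hs hr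
  obtain ⟨t, ht, hrt, hc'⟩ := h'.exists_face n' hn s' hs' hr'
  exact ⟨t, ht, hrt, hc.trans hc'⟩

theorem Refines.exists_face' {r : E → ℕ} {n : ℕ} {S S' : Finset (Finset E)}
    (h : Refines r n S' S) {s' : Finset E} (hs' : s' ∈ S') :
    ∃ s ∈ S, convexHull ℝ (s' : Set E) ⊆ convexHull ℝ (s : Set E) := by
  obtain ⟨s, hs, _, hc⟩ := h.exists_face (max n (s'.sup r)) (le_max_left _ _) s' hs'
    fun v hv => (Finset.le_sup hv).trans (le_max_right _ _)
  exact ⟨s, hs, hc⟩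

/-- A new face `insert m t` lies in `insert a (insert b t)`, and the added vertices `a`, `b` have
rank at most `n`. So every rank bound `n' ≥ n` passes from the new face to the old one. -/
theorem refines_bisect {r : E → ℕ} {n : ℕ} {S : Finset (Finset E)} (hS : IsComplex S) {a b m : E}
    (hab : a ≠ b) (habS : {a, b} ∈ S) (hm : m ∈ openSegment ℝ a b) (ha : r a ≤ n)
    (hb : r b ≤ n) : IsComplex (bisect S a b m) ∧ Refines r n (bisect S a b m) S := by
  obtain ⟨p, q, hp, hq, hpq, rfl⟩ := hm
  obtain ⟨h1, h2⟩ := hS.bisect hab habS hq (by linarith)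
    (show p • a + q • b = (1 - q) • a + q • b by rw [show 1 - q = p by linarith])
  refine ⟨h1, h2, fun n' hn s hs hr => ?_⟩
  rcases mem_bisect.1 hs with h | ⟨t, ht, -, htab, rfl⟩
  · exact ⟨s, h.1, hr, subset_rfl⟩
  · refine ⟨_, htab, ?_, convexHull_min ?_ (convex_convexHull ℝ _)⟩
    · simp only [Finset.forall_mem_insert] at hr ⊢
      exact ⟨ha.trans hn, hb.trans hn, hr.2⟩
    · rw [Finset.coe_insert, insert_subset_iff]
      constructor
      · exact (convex_convexHull ℝ _) (subset_convexHull ℝ _ (by simp))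
          (subset_convexHull ℝ _ (by simp)) hp.le hq.le hpq
      · exact fun v hv => subset_convexHull ℝ _ (by
          simp only [Finset.coe_insert]; exact Or.inr (Or.inr hv))

/-- Bisecting bad edges terminates, if the bad edges at each new vertex have lower level. -/
theorem exists_refines_forall_not {r : E → ℕ} {n : ℕ} (Bad : E → E → Prop) (lev : E → E → ℕ)
    (M : E → E → E) (hsymm : ∀ a b, Bad a b → Bad b a) (hlev : ∀ a b, lev a b = lev b a)
    (hr : ∀ a b, Bad a b → r a ≤ n) (hne : ∀ a b, Bad a b → a ≠ b)
    (hM : ∀ a b, Bad a b → M a b ∈ openSegment ℝ a b)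
    (hnew : ∀ a b c, Bad a b → Bad (M a b) c → lev (M a b) c < lev a b) (j : ℕ) :
    ∀ S : Finset (Finset E), IsComplex S →
      (∀ s ∈ S, ∀ a ∈ s, ∀ b ∈ s, Bad a b → lev a b < j) →
      ∃ S', IsComplex S' ∧ Refines r n S' S ∧ ∀ s ∈ S', ∀ a ∈ s, ∀ b ∈ s, ¬ Bad a b := by
  induction j with
  | zero => exact fun S hS h => ⟨S, hS, Refines.refl _ _ _, fun s hs a ha b hb hab =>
      absurd (h s hs a ha b hb hab) (Nat.not_lt_zero _)⟩
  | succ j ih =>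
    -- The bad pairs of the top level `j`. An inner induction on their number suffices: a bisection
    -- destroys one of them and creates bad pairs of lower level only.
    let P : Finset (Finset E) → Finset (E × E) := fun S =>
      (S.biUnion id ×ˢ S.biUnion id).filter
        (fun p => ∃ s ∈ S, p.1 ∈ s ∧ p.2 ∈ s ∧ Bad p.1 p.2 ∧ lev p.1 p.2 = j)
    have hP : ∀ S p, p ∈ P S ↔ ∃ s ∈ S, p.1 ∈ s ∧ p.2 ∈ s ∧ Bad p.1 p.2 ∧ lev p.1 p.2 = j := by
      intro S p
      simp only [P, Finset.mem_filter, Finset.mem_product, Finset.mem_biUnion, id]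
      exact ⟨fun h => h.2, fun ⟨s, hs, h1, h2, h3⟩ =>
        ⟨⟨⟨s, hs, h1⟩, ⟨s, hs, h2⟩⟩, s, hs, h1, h2, h3⟩⟩
    intro S
    induction hN : (P S).card using Nat.strong_induction_on generalizing S with
    | _ N IH =>
      intro hS hbad
      by_cases hex : ∃ p, p ∈ P S
      · obtain ⟨⟨a, b⟩, hp⟩ := hex
        have hp' := hp
        rw [hP] at hp
        obtain ⟨s, hs, ha, hb, hab, hj⟩ := hp
        simp only at ha hb hab hj
        have hmo := hM a b hab
        have hne' := hne a b hab
        have hma : M a b ≠ a := fun h => by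
          rw [h] at hmo
          exact hne' (left_mem_openSegment_iff.1 hmo)
        have hmb : M a b ≠ b := fun h => by
          rw [h] at hmo
          exact hne' (right_mem_openSegment_iff.1 hmo)
        obtain ⟨h1, h2⟩ := refines_bisect hS hne' (hS.down s hs _ (by
          simp [Finset.insert_subset_iff, ha, hb])) hmo (hr a b hab) (hr b a (hsymm _ _ hab))
        set S1 := bisect S a b (M a b) with hS1
        have hedge : ∀ s' ∈ S1, ∀ u ∈ s', ∀ v ∈ s', Bad u v →
            lev u v < j ∨ ∃ s ∈ S, u ∈ s ∧ v ∈ s := by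
          intro s' hs' u hu v hv huv
          rcases mem_bisect.1 hs' with h | ⟨t, ht, -, -, rfl⟩
          · exact Or.inr ⟨s', h.1, hu, hv⟩
          · by_cases hum : u = M a b
            · subst hum
              exact Or.inl (hj ▸ hnew a b v hab huv)
            by_cases hvm : v = M a b
            · subst hvm
              rw [hlev]
              exact Or.inl (hj ▸ hnew a b u hab (hsymm _ _ huv))
            exact Or.inr ⟨t, ht, (Finset.mem_insert.1 hu).resolve_left hum,
              (Finset.mem_insert.1 hv).resolve_left hvm⟩
        have hlt : (P S1).card < N := by
          rw [← hN]
          refine Finset.card_lt_card ((Finset.ssubset_iff_of_subset ?_).2 ⟨(a, b), hp', ?_⟩)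
          · intro p hp
            rw [hP] at hp ⊢
            obtain ⟨s', hs', hu, hv, huv, hl⟩ := hp
            rcases hedge s' hs' _ hu _ hv huv with h | ⟨s, hs, h3, h4⟩
            · exact absurd hl h.ne
            · exact ⟨s, hs, h3, h4, huv, hl⟩
          · rw [hP]
            rintro ⟨s', hs', hu, hv, -⟩
            exact not_mem_and_mem_of_mem_bisect hma hmb hs' ⟨hu, hv⟩
        obtain ⟨S', hS', hre, hS'b⟩ := IH _ hlt S1 rfl h1 (by
          intro s' hs' u hu v hv huv
          rcases hedge s' hs' _ hu _ hv huv with h | ⟨s, hs, h3, h4⟩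
          · exact h.trans (Nat.lt_succ_self _)
          · exact hbad s hs u h3 v h4 huv)
        exact ⟨S', hS', hre.trans h2, hS'b⟩
      · refine ih S hS fun s hs a ha b hb hab => ?_
        refine lt_of_le_of_ne (Nat.lt_succ_iff.1 (hbad s hs a ha b hb hab)) fun hj => hex ⟨(a, b), ?_⟩
        rw [hP]
        exact ⟨s, hs, ha, hb, hab, hj⟩

end Bisection

/-! ### Cutting faces by affine functionals -/

section Cuts

variable {E V : Type*} [AddCommGroup E] [Module ℝ E] [AddCommGroup V] [Module ℝ V]

/-- The functional `ℓ` does not change sign on `C`. -/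
def WeakSign (ℓ : E →ᵃ[ℝ] ℝ) (C : Set E) : Prop :=
  (∀ x ∈ C, ℓ x ≤ 0) ∨ (∀ x ∈ C, 0 ≤ ℓ x)

theorem WeakSign.mono {ℓ : E →ᵃ[ℝ] ℝ} {C C' : Set E} (h : WeakSign ℓ C) (hC : C' ⊆ C) :
    WeakSign ℓ C' :=
  h.imp (fun h x hx => h x (hC hx)) (fun h x hx => h x (hC hx))

theorem WeakSign.convexHull {ℓ : E →ᵃ[ℝ] ℝ} {s : Set E} (h : WeakSign ℓ s) :
    WeakSign ℓ (convexHull ℝ s) :=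
  h.imp (fun h => convexHull_min h ((convex_Iic (0 : ℝ)).affine_preimage ℓ))
    (fun h => convexHull_min h ((convex_Ici (0 : ℝ)).affine_preimage ℓ))

theorem WeakSign.le_of_mem_support {ℓ : E →ᵃ[ℝ] ℝ} {w : E →₀ ℝ} (hw : IsWeight w)
    (h : WeakSign ℓ (w.support : Set E)) (hle : ℓ (lc id w) ≤ 0) :
    ∀ v ∈ w.support, ℓ v ≤ 0 := by
  intro v hv
  rcases h with h | h
  · exact h v hv
  · rw [affineMap_lc ℓ hw.mass, lc_eq_sum subset_rfl] at hle
    by_contra! hlt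
    have : 0 < ∑ v ∈ w.support, w v • ℓ v :=
      Finset.sum_pos' (fun u hu => mul_nonneg (hw.nonneg u) (h u hu))
        ⟨v, hv, mul_pos (hw.pos hv) hlt⟩
    exact absurd hle (not_le.2 this)

/-- Edges whose ends have opposite signs are bisected at the zero of `ℓ`. The new vertex lies on no
such edge, so one level is enough. -/
theorem exists_refines_weakSign_one (r : E → ℕ) (n : ℕ) {S : Finset (Finset E)}
    (hS : IsComplex S) (ℓ : E →ᵃ[ℝ] ℝ) :
    ∃ S', IsComplex S' ∧ Refines r n S' S ∧
      ∀ s ∈ S', (∀ v ∈ s, r v ≤ n) → WeakSign ℓ (convexHull ℝ (s : Set E)) := by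
  have hM0 : ∀ a b, ℓ a * ℓ b < 0 → ℓ (AffineMap.lineMap a b (ℓ a / (ℓ a - ℓ b))) = 0 := by
    intro a b h
    have : ℓ a - ℓ b ≠ 0 := fun h0 => by
      rw [sub_eq_zero.1 h0] at h
      exact absurd h (not_lt.2 (mul_self_nonneg _))
    rw [AffineMap.apply_lineMap, AffineMap.lineMap_apply_module]
    simp only [smul_eq_mul]
    field_simp
    ring
  obtain ⟨S', hS', hre, hbad⟩ := exists_refines_forall_not (r := r) (n := n)
    (fun a b => r a ≤ n ∧ r b ≤ n ∧ ℓ a * ℓ b < 0) (fun _ _ => 0)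
    (fun a b => AffineMap.lineMap a b (ℓ a / (ℓ a - ℓ b)))
    (fun a b h => ⟨h.2.1, h.1, by rw [mul_comm]; exact h.2.2⟩) (fun _ _ => rfl)
    (fun a b h => h.1)
    (by rintro a _ h rfl; exact absurd h.2.2 (not_lt.2 (mul_self_nonneg _)))
    (by
      intro a b h
      rw [openSegment_eq_image_lineMap]
      refine ⟨_, ?_, rfl⟩
      rcases mul_neg_iff.1 h.2.2 with ⟨h1, h2⟩ | ⟨h1, h2⟩
      · exact ⟨div_pos h1 (by linarith), (div_lt_one (by linarith)).2 (by linarith)⟩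
      · exact ⟨div_pos_of_neg_of_neg h1 (by linarith),
          (div_lt_one_of_neg (by linarith)).2 (by linarith)⟩)
    (by
      intro a b c h h'
      simp [hM0 a b h.2.2] at h')
    1 S hS (fun _ _ _ _ _ _ _ => Nat.zero_lt_one)
  refine ⟨S', hS', hre, fun s hs hr => WeakSign.convexHull ?_⟩
  by_cases h : ∀ v ∈ s, ℓ v ≤ 0
  · exact Or.inl h
  push Not at h
  obtain ⟨a, ha, hpos⟩ := h
  refine Or.inr fun b hb => ?_
  by_contra! hneg
  exact hbad s hs a ha b hb ⟨hr a ha, hr b hb, mul_neg_of_pos_of_neg hpos hneg⟩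

/-- Faces of rank at most `n` can be subdivided so that given functionals do not change sign on
them. -/
theorem exists_refines_weakSign (r : E → ℕ) (n : ℕ) (Λ : Finset (E →ᵃ[ℝ] ℝ))
    {S : Finset (Finset E)} (hS : IsComplex S) :
    ∃ S', IsComplex S' ∧ Refines r n S' S ∧
      ∀ ℓ ∈ Λ, ∀ s ∈ S', (∀ v ∈ s, r v ≤ n) → WeakSign ℓ (convexHull ℝ (s : Set E)) := by
  induction Λ using Finset.induction_on with
  | empty => exact ⟨S, hS, Refines.refl _ _ _, by simp⟩
  | insert ℓ Λ _ ih =>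
    obtain ⟨S1, hS1, hre1, h1⟩ := ih
    obtain ⟨S2, hS2, hre2, h2⟩ := exists_refines_weakSign_one r n hS1 ℓ
    refine ⟨S2, hS2, hre2.trans hre1, fun ℓ' hℓ' s hs hr => ?_⟩
    rcases Finset.mem_insert.1 hℓ' with rfl | h
    · exact h2 s hs hr
    · obtain ⟨t, ht, hrt, hst⟩ := hre2.exists_face n le_rfl s hs hr
      exact (h1 ℓ' h t ht hrt).mono hst

/-- Values on affinely independent points extend to an affine map. -/
theorem exists_affineMap_eq {s : Finset E} (hs : AffineIndependent ℝ ((↑) : s → E))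
    (φ : E → V) : ∃ A : E →ᵃ[ℝ] V, ∀ u ∈ s, A u = φ u := by
  rcases s.eq_empty_or_nonempty with rfl | ⟨a, ha⟩
  · exact ⟨AffineMap.const ℝ E 0, by simp⟩
  have hs' : AffineIndependent ℝ (fun p : (s : Set E) => (p : E)) := hs
  rw [affineIndependent_set_iff_linearIndependent_vsub ℝ (show a ∈ (s : Set E) from ha)] at hs'
  have hli : LinearIndepOn ℝ id ((fun p : E => p -ᵥ a) '' ((s : Set E) \ {a})) := hs'
  let b := Module.Basis.extend hli
  let L : E →ₗ[ℝ] V := b.constr ℝ (fun i => φ ((i : E) + a) - φ a)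
  refine ⟨(L.toAffineMap.comp (AffineMap.id ℝ E - AffineMap.const ℝ E a)) +
    AffineMap.const ℝ E (φ a), fun u hu => ?_⟩
  by_cases hua : u = a
  · subst hua; simp
  · have hmem : u - a ∈ (fun p : E => p -ᵥ a) '' ((s : Set E) \ {a}) := ⟨u, ⟨hu, hua⟩, rfl⟩
    have hL : L (u - a) = φ u - φ a := by
      have h1 := b.constr_basis ℝ (fun i => φ ((i : E) + a) - φ a)
        ⟨u - a, hli.subset_extend (subset_univ _) hmem⟩
      simpa [b, L] using h1
    rw [map_sub] at hL
    simp [hL]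

/-- A simplex is a finite intersection of half-spaces. -/
theorem exists_halfspaces [FiniteDimensional ℝ E] {s : Finset E}
    (hs : AffineIndependent ℝ ((↑) : s → E)) :
    ∃ Λ : Finset (E →ᵃ[ℝ] ℝ), convexHull ℝ (s : Set E) = {x | ∀ ℓ ∈ Λ, ℓ x ≤ 0} := by
  -- `A` extends the barycentric coordinates of `s` to the whole space. Off the affine span their
  -- values mean nothing, so besides nonnegativity they must sum to one and reproduce `x`. This is
  -- `Z x = 0`, expressed by pairs of opposite inequalities.
  obtain ⟨A, hA⟩ := exists_affineMap_eq hs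
    (fun u => (fun v : s => if u = v then (1 : ℝ) else 0))
  let L : (s → ℝ) →ₗ[ℝ] E × ℝ :=
    (Fintype.linearCombination ℝ (fun v : s => (v : E))).prod
      (Fintype.linearCombination ℝ (fun _ : s => (1 : ℝ)))
  let Z : E →ᵃ[ℝ] E × ℝ := L.toAffineMap.comp A -
    ((LinearMap.inl ℝ E ℝ).toAffineMap + AffineMap.const ℝ E (0, 1))
  have hZ : ∀ x, Z x = (∑ v : s, A x v • (v : E) - x, ∑ v : s, A x v - 1) := by
    intro x
    simp [Z, L, Fintype.linearCombination_apply]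
  let b := Module.finBasis ℝ (E × ℝ)
  let Λ : Finset (E →ᵃ[ℝ] ℝ) :=
    Finset.univ.image (fun v : s => -((LinearMap.proj v : (s → ℝ) →ₗ[ℝ] ℝ).toAffineMap.comp A)) ∪
    (Finset.univ.image (fun i => (b.coord i).toAffineMap.comp Z) ∪
      Finset.univ.image (fun i => -((b.coord i).toAffineMap.comp Z)))
  have hΛ : ∀ x, (∀ ℓ ∈ Λ, ℓ x ≤ 0) ↔ (∀ v, 0 ≤ A x v) ∧ Z x = 0 := by
    intro x
    have h0 : Z x = 0 ↔ ∀ i, b.coord i (Z x) = 0 := (b.forall_coord_eq_zero_iff).symm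
    rw [h0]
    simp only [Λ, Finset.mem_union, Finset.mem_image, Finset.mem_univ, true_and]
    constructor
    · intro h
      refine ⟨fun v => ?_, fun i => le_antisymm ?_ ?_⟩
      · have := h _ (Or.inl ⟨v, rfl⟩)
        simpa using this
      · simpa using h _ (Or.inr (Or.inl ⟨i, rfl⟩))
      · simpa using h _ (Or.inr (Or.inr ⟨i, rfl⟩))
    · rintro ⟨h1, h2⟩ ℓ (⟨v, rfl⟩ | ⟨i, rfl⟩ | ⟨i, rfl⟩)
      · simpa using h1 v
      · simpa using (h2 i).le
      · simpa using (h2 i).ge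
  refine ⟨Λ, subset_antisymm (fun x hx ℓ hℓ => ?_) fun x hx => ?_⟩
  · refine convexHull_min (t := {x | ℓ x ≤ 0}) (fun u hu => ?_)
      ((convex_Iic (0 : ℝ)).affine_preimage ℓ) hx
    refine (hΛ u).2 ⟨fun v => ?_, ?_⟩ ℓ hℓ
    · rw [hA u hu]
      simp only
      split_ifs <;> norm_num
    · rw [hZ, hA u hu]
      have h1 : ∀ v : s, (u = (v : E)) ↔ v = ⟨u, hu⟩ := fun v => by
        rw [Subtype.ext_iff]; exact eq_comm
      simp [h1]
  · obtain ⟨h1, h2⟩ := (hΛ x).1 hx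
    rw [hZ, Prod.mk_eq_zero] at h2
    have h3 := sub_eq_zero.1 h2.1
    rw [← h3]
    exact (convex_convexHull ℝ _).sum_mem (fun v _ => h1 v) (sub_eq_zero.1 h2.2)
      fun v _ => subset_convexHull ℝ _ v.2

end Cuts

/-! ### Separating pairs of points by finitely many functionals -/

section Separation

variable {E : Type*} [NormedAddCommGroup E] [NormedSpace ℝ E] [FiniteDimensional ℝ E]

omit [FiniteDimensional ℝ E] in
theorem exists_affineMap_neg_pos {x y : E} (hxy : x ≠ y) :
    ∃ ℓ : E →ᵃ[ℝ] ℝ, ℓ x < 0 ∧ 0 < ℓ y := by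
  obtain ⟨f, hf⟩ := SeparatingDual.exists_separating_of_ne (R := ℝ) hxy
  -- The factor `f y - f x` makes the signs come out right whichever of the two values is larger.
  refine ⟨(f y - f x) • ((f : E →ₗ[ℝ] ℝ).toAffineMap - AffineMap.const ℝ E ((f x + f y) / 2)),
    ?_, ?_⟩
  · have : 0 < (f y - f x) ^ 2 := by
      have := sub_ne_zero.2 (Ne.symm hf)
      positivity
    simp
    nlinarith
  · have : 0 < (f y - f x) ^ 2 := by
      have := sub_ne_zero.2 (Ne.symm hf)
      positivity
    simp
    nlinarith

/-- Finitely many functionals separate the pairs in a compact set off the diagonal. -/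
theorem exists_finset_separating {Q : Set (E × E)} (hQ : IsCompact Q)
    (hne : ∀ p ∈ Q, p.1 ≠ p.2) :
    ∃ Λ : Finset (E →ᵃ[ℝ] ℝ), ∀ C : Set E, (∀ ℓ ∈ Λ, WeakSign ℓ C) →
      ∀ x ∈ C, ∀ y ∈ C, (x, y) ∉ Q := by
  have hex : ∀ p : E × E, ∃ ℓ : E →ᵃ[ℝ] ℝ, p ∈ Q → ℓ p.1 < 0 ∧ 0 < ℓ p.2 := fun p => by
    by_cases hp : p ∈ Q
    · obtain ⟨ℓ, h⟩ := exists_affineMap_neg_pos (hne p hp)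
      exact ⟨ℓ, fun _ => h⟩
    · exact ⟨0, fun h => absurd h hp⟩
  choose ℓ hℓ using hex
  obtain ⟨t, -, ht⟩ := hQ.elim_nhds_subcover (fun p => {q : E × E | ℓ p q.1 < 0 ∧ 0 < ℓ p q.2})
    (fun p hp => by
      have hc : Continuous (ℓ p) := AffineMap.continuous_of_finiteDimensional _
      exact ((isOpen_lt (hc.comp continuous_fst) continuous_const).inter
        (isOpen_lt continuous_const (hc.comp continuous_snd))).mem_nhds (hℓ p hp))
  refine ⟨t.image ℓ, fun C hC x hx y hy hxy => ?_⟩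
  obtain ⟨p, hp, h1, h2⟩ := mem_iUnion₂.1 (ht hxy)
  rcases hC (ℓ p) (Finset.mem_image_of_mem _ hp) with h | h
  · exact absurd (h y hy) (not_le.2 h2)
  · exact absurd (h x hx) (not_le.2 h1)

end Separation

/-! ### Subdivisions adapted to a family of convex sets -/

section Adapted

variable {ι F : Type*} [AddCommGroup F] [Module ℝ F]

/-- The members of the family `P` containing `x`. -/
noncomputable def typ (I : Finset ι) (P : ι → Set F) (x : F) : Finset ι :=
  I.filter (fun i => x ∈ P i)

omit [AddCommGroup F] [Module ℝ F] in
theorem mem_typ {I : Finset ι} {P : ι → Set F} {x : F} {i : ι} :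
    i ∈ typ I P x ↔ i ∈ I ∧ x ∈ P i := Finset.mem_filter

/-- The half-spaces defined by `Λ` cut out the members of the family `P`. -/
def IsCutOut (I : Finset ι) (P : ι → Set F) (Λ : ι → Finset (F →ᵃ[ℝ] ℝ)) : Prop :=
  ∀ i ∈ I, P i = {x | ∀ ℓ ∈ Λ i, ℓ x ≤ 0}

/-- No functional in `Λ` changes sign on a face of `S`. -/
def IsCut (I : Finset ι) (Λ : ι → Finset (F →ᵃ[ℝ] ℝ)) (S : Finset (Finset F)) : Prop :=
  ∀ i ∈ I, ∀ ℓ ∈ Λ i, ∀ s ∈ S, WeakSign ℓ (convexHull ℝ (s : Set F))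

/-- The types of the points of a face of `S` form a chain. -/
def IsChainTyped (I : Finset ι) (P : ι → Set F) (S : Finset (Finset F)) : Prop :=
  ∀ s ∈ S, ∀ x ∈ convexHull ℝ (s : Set F), ∀ y ∈ convexHull ℝ (s : Set F),
    typ I P x ⊆ typ I P y ∨ typ I P y ⊆ typ I P x

variable {I : Finset ι} {P : ι → Set F} {Λ : ι → Finset (F →ᵃ[ℝ] ℝ)}

theorem IsCutOut.convex (h : IsCutOut I P Λ) {i : ι} (hi : i ∈ I) : Convex ℝ (P i) := by
  rw [h i hi]
  have : {x | ∀ ℓ ∈ Λ i, ℓ x ≤ 0} = ⋂ ℓ ∈ Λ i, ℓ ⁻¹' (Iic (0 : ℝ)) := by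
    ext x; simp
  rw [this]
  exact convex_iInter₂ fun ℓ _ => (convex_Iic (0 : ℝ)).affine_preimage ℓ

/-- A half-space inequality at a point of the face passes to every vertex of positive weight,
because the functional keeps its sign there. The converse is convexity. -/
theorem IsCut.mem_iff (h : IsCutOut I P Λ) {S : Finset (Finset F)} (hS : IsCut I Λ S) {i : ι}
    (hi : i ∈ I) {w : F →₀ ℝ} (hw : IsWeight w) {s : Finset F} (hs : s ∈ S)
    (hws : w.support ⊆ s) : lc id w ∈ P i ↔ ∀ v ∈ w.support, v ∈ P i := by
  constructor
  · intro hx v hv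
    rw [h i hi] at hx ⊢
    exact fun ℓ hℓ => ((hS i hi ℓ hℓ s hs).mono fun u hu =>
      subset_convexHull ℝ _ (hws hu)).le_of_mem_support hw (hx ℓ hℓ) v hv
  · intro hv
    have := hw.lc_mem_convexHull subset_rfl id
    rw [image_id] at this
    exact convexHull_min hv (h.convex hi) this

theorem IsCut.typ_lc (h : IsCutOut I P Λ) {S : Finset (Finset F)} (hS : IsCut I Λ S)
    {w : F →₀ ℝ} (hw : IsWeight w) {s : Finset F} (hs : s ∈ S) (hws : w.support ⊆ s) (i : ι) :
    i ∈ typ I P (lc id w) ↔ ∀ v ∈ w.support, i ∈ typ I P v := by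
  simp only [mem_typ]
  constructor
  · rintro ⟨hi, hx⟩ v hv
    exact ⟨hi, (hS.mem_iff h hi hw hs hws).1 hx v hv⟩
  · intro hv
    obtain ⟨v, hvs⟩ := hw.support_nonempty
    have hi := (hv v hvs).1
    exact ⟨hi, (hS.mem_iff h hi hw hs hws).2 fun v hvs => (hv v hvs).2⟩

/-- A point of a face with comparable vertices has the type of a vertex. -/
theorem IsCut.exists_typ_eq (h : IsCutOut I P Λ) {S : Finset (Finset F)} (hS : IsCut I Λ S)
    {s : Finset F} (hs : s ∈ S)
    (hch : ∀ a ∈ s, ∀ b ∈ s, typ I P a ⊆ typ I P b ∨ typ I P b ⊆ typ I P a) {x : F}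
    (hx : x ∈ convexHull ℝ (s : Set F)) : ∃ v ∈ s, typ I P x = typ I P v := by
  obtain ⟨w, hw, hws, rfl⟩ := mem_convexHull_iff_weight.1 hx
  -- The type of a point is the intersection of the types of its supporting vertices; in a chain
  -- this is the one with fewest members.
  obtain ⟨v, hv, hmin⟩ := w.support.exists_min_image (fun v => (typ I P v).card)
    hw.support_nonempty
  refine ⟨v, hws hv, ?_⟩
  ext i
  rw [hS.typ_lc h hw hs hws]
  refine ⟨fun hh => hh v hv, fun hi u hu => ?_⟩
  rcases hch v (hws hv) u (hws hu) with hsub | hsub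
  · exact hsub hi
  · rw [Finset.eq_of_subset_of_card_le hsub (hmin u hu)]
    exact hi

theorem IsCut.of_refines {r : F → ℕ} {n : ℕ} {S S' : Finset (Finset F)} (h : IsCut I Λ S)
    (hr : Refines r n S' S) : IsCut I Λ S' := by
  intro i hi ℓ hℓ s hs
  obtain ⟨t, ht, hst⟩ := hr.exists_face' hs
  exact (h i hi ℓ hℓ t ht).mono hst

theorem IsChainTyped.of_refines {r : F → ℕ} {n : ℕ} {S S' : Finset (Finset F)}
    (h : IsChainTyped I P S) (hr : Refines r n S' S) : IsChainTyped I P S' := by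
  intro s hs x hx y hy
  obtain ⟨t, ht, hst⟩ := hr.exists_face' hs
  exact h t ht x (hst hx) y (hst hy)

theorem exists_isCut (Λ : ι → Finset (F →ᵃ[ℝ] ℝ)) (I : Finset ι) {S : Finset (Finset F)}
    (hS : IsComplex S) : ∃ S', IsComplex S' ∧ Refines (fun _ => 0) 0 S' S ∧ IsCut I Λ S' := by
  obtain ⟨S', hS', hr, h⟩ := exists_refines_weakSign (fun _ => 0) 0 (I.biUnion Λ) hS
  exact ⟨S', hS', hr, fun i hi ℓ hℓ s hs =>
    h ℓ (Finset.mem_biUnion.2 ⟨i, hi, hℓ⟩) s hs fun _ _ => le_rfl⟩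

/-- Every complex has a subdivision on whose faces the types of points form chains. -/
theorem exists_isChainTyped (h : IsCutOut I P Λ) {S : Finset (Finset F)} (hS : IsComplex S)
    (hcut : IsCut I Λ S) :
    ∃ S', IsComplex S' ∧ Refines (fun _ => 0) 0 S' S ∧ IsCut I Λ S' ∧ IsChainTyped I P S' := by
  let T := typ I P
  -- Incomparable ends are bisected at the midpoint, of type `T a ∩ T b`. If the midpoint is in turn
  -- incomparable with `c`, intersecting with `T c` makes its type strictly smaller, so the level
  -- drops. The clause on the midpoint holds on every edge of a cut complex; it is part of badness
  -- because badness is a relation between points, independent of the complex.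
  obtain ⟨S', hS', hr, hbad⟩ := exists_refines_forall_not (r := fun _ => 0) (n := 0)
    (fun a b => ¬(T a ⊆ T b) ∧ ¬(T b ⊆ T a) ∧ T (midpoint ℝ a b) = T a ∩ T b)
    (fun a b => (T a ∩ T b).card) (fun a b => midpoint ℝ a b)
    (fun a b h => ⟨h.2.1, h.1, by rw [midpoint_comm, Finset.inter_comm]; exact h.2.2⟩)
    (fun a b => by simp only [Finset.inter_comm])
    (fun _ _ _ => le_rfl)
    (by rintro a _ h rfl; exact h.1 subset_rfl)
    (fun a b h => ⟨1 / 2, 1 / 2, by norm_num, by norm_num, by norm_num, by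
      rw [midpoint_eq_smul_add]; simp [smul_add]⟩)
    (fun a b c hab hmc => by
      rw [← hab.2.2]
      refine Finset.card_lt_card ⟨Finset.inter_subset_left, fun hsub => hmc.1 ?_⟩
      exact hsub.trans Finset.inter_subset_right)
    (I.card + 1) S hS
    (fun _ _ a _ b _ _ => Nat.lt_succ_of_le (Finset.card_le_card
      (Finset.inter_subset_left.trans (Finset.filter_subset _ _))))
  have hcut' := hcut.of_refines hr
  have hch : ∀ s ∈ S', ∀ a ∈ s, ∀ b ∈ s, T a ⊆ T b ∨ T b ⊆ T a := by
    intro s hs a ha b hb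
    by_contra! hcon
    refine hbad s hs a ha b hb ⟨hcon.1, hcon.2, ?_⟩
    have hne : a ≠ b := fun h => hcon.1 (h ▸ subset_rfl)
    let w : F →₀ ℝ := Finsupp.single a (1 / 2) + Finsupp.single b (1 / 2)
    have hwv : ∀ v, w v = (if a = v then 1 / 2 else 0) + (if b = v then 1 / 2 else 0) := fun v => by
      simp [w, Finsupp.single_apply]
    have hw : IsWeight w := ⟨fun v => by rw [hwv]; split_ifs <;> norm_num, by
      simp only [w, map_add, lc, Finsupp.linearCombination_single]; norm_num⟩
    have hsup : ∀ v, v ∈ w.support ↔ v = a ∨ v = b := by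
      intro v
      rw [Finsupp.mem_support_iff, hwv]
      by_cases h1 : a = v
      · subst h1; simp [hne.symm]
      · by_cases h2 : b = v
        · subst h2; simp [h1]
        · simp [h1, h2, Ne.symm h1, Ne.symm h2]
    have hlc : lc id w = midpoint ℝ a b := by
      simp only [w, map_add, lc, Finsupp.linearCombination_single, id]
      rw [midpoint_eq_smul_add]
      simp [smul_add]
    ext i
    rw [← hlc, hcut'.typ_lc h hw hs (fun v hv => by
      rcases (hsup v).1 hv with rfl | rfl <;> assumption), Finset.mem_inter]
    simp only [hsup]
    exact ⟨fun hh => ⟨hh a (Or.inl rfl), hh b (Or.inr rfl)⟩,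
      fun hh v hv => by rcases hv with rfl | rfl; exacts [hh.1, hh.2]⟩
  refine ⟨S', hS', hr, hcut', fun s hs x hx y hy => ?_⟩
  obtain ⟨u, hu, hxu⟩ := hcut'.exists_typ_eq h hs (hch s hs) hx
  obtain ⟨v, hv, hyv⟩ := hcut'.exists_typ_eq h hs (hch s hs) hy
  rw [hxu, hyv]
  exact hch s hs u hu v hv

end Adapted

/-! ### Separating the sheets away from their coincidences -/

section Separated

variable {ι F W : Type*} [NormedAddCommGroup F] [NormedSpace ℝ F] [FiniteDimensional ℝ F]
  [NormedAddCommGroup W] [NormedSpace ℝ W]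

/-- Two maps without coincidences have disjoint convex hulls of images on the sets which some
finite set of functionals does not cut. -/
theorem exists_finset_disjoint {Q : Set F} (hQ : IsCompact Q) {G G' : F → W}
    (hG : ContinuousOn G Q) (hG' : ContinuousOn G' Q) (hne : ∀ q ∈ Q, G q ≠ G' q) :
    ∃ Λ : Finset (F →ᵃ[ℝ] ℝ), ∀ C ⊆ Q, (∀ ℓ ∈ Λ, WeakSign ℓ C) →
      Disjoint (convexHull ℝ (G '' C)) (convexHull ℝ (G' '' C)) := by
  rcases Q.eq_empty_or_nonempty with rfl | hQne
  · exact ⟨∅, fun C hC _ => by rw [subset_empty_iff.1 hC]; simp⟩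
  obtain ⟨q0, hq0, hmin⟩ := hQ.exists_isMinOn hQne (continuous_dist.comp_continuousOn (hG.prodMk hG'))
  -- The least distance between the two maps. Pairs of points whose images under one map are at
  -- least `η / 2` apart form a compact set off the diagonal. If no functional separating these
  -- pairs cuts `C`, the images of `C` lie in balls of radius `η / 2` about `G y` and `G' y`. These
  -- are convex, and disjoint since their centres are at least `η` apart.
  set η := dist (G q0) (G' q0) with hη
  have hη0 : 0 < η := dist_pos.2 (hne q0 hq0)
  have hη' : ∀ q ∈ Q, η ≤ dist (G q) (G' q) := fun q hq => hmin hq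
  have main : ∀ {H : F → W}, ContinuousOn H Q → ∃ Λ : Finset (F →ᵃ[ℝ] ℝ), ∀ C ⊆ Q,
      (∀ ℓ ∈ Λ, WeakSign ℓ C) → ∀ y ∈ C, H '' C ⊆ Metric.ball (H y) (η / 2) := by
    intro H hH
    have hc : ContinuousOn (fun p : F × F => dist (H p.1) (H p.2)) (Q ×ˢ Q) :=
      continuous_dist.comp_continuousOn ((hH.comp continuousOn_fst fun _ hp => hp.1).prodMk
        (hH.comp continuousOn_snd fun _ hp => hp.2))
    have hcl := hc.preimage_isClosed_of_isClosed (hQ.prod hQ).isClosed (isClosed_Ici (a := η / 2))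
    obtain ⟨Λ, hΛ⟩ := exists_finset_separating ((hQ.prod hQ).of_isClosed_subset hcl
      inter_subset_left) (by
        intro p hp heq
        have : η / 2 ≤ dist (H p.1) (H p.2) := hp.2
        rw [heq, dist_self] at this
        linarith)
    refine ⟨Λ, fun C hC hs y hy => ?_⟩
    rintro _ ⟨x, hx, rfl⟩
    rw [Metric.mem_ball]
    by_contra! hle
    exact hΛ C hs x hx y hy ⟨⟨hC hx, hC hy⟩, hle⟩
  obtain ⟨Λ, hΛ⟩ := main hG
  obtain ⟨Λ', hΛ'⟩ := main hG'
  refine ⟨Λ ∪ Λ', fun C hC hs => ?_⟩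
  rcases C.eq_empty_or_nonempty with rfl | ⟨y, hy⟩
  · simp
  have h1 := hΛ C hC (fun ℓ hℓ => hs ℓ (Finset.mem_union_left _ hℓ)) y hy
  have h2 := hΛ' C hC (fun ℓ hℓ => hs ℓ (Finset.mem_union_right _ hℓ)) y hy
  refine (Metric.ball_disjoint_ball ?_).mono (convexHull_min h1 (convex_ball _ _))
    (convexHull_min h2 (convex_ball _ _))
  rw [add_halves]
  exact hη' y (hC hy)

variable {I : Finset ι} {P : ι → Set F} {Λ : ι → Finset (F →ᵃ[ℝ] ℝ)}

/-- On the faces whose points of least depth lie in exactly `n` members of `P`, the maps `G i` and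
`G j` are separated unless such a point lies in `P (c i j)`. -/
def IsSeparated (I : Finset ι) (P : ι → Set F) (G : ι → F → W) (c : ι → ι → ι) (n : ℕ)
    (S : Finset (Finset F)) : Prop :=
  ∀ s ∈ S, (∀ v ∈ s, (typ I P v).card ≤ n) → ∀ i ∈ I, ∀ j ∈ I,
    (∃ y ∈ convexHull ℝ (s : Set F) ∩ (P i ∩ P j), (typ I P y).card = n ∧ y ∉ P (c i j)) →
    Disjoint (convexHull ℝ (G i '' (convexHull ℝ (s : Set F) ∩ (P i ∩ P j))))
      (convexHull ℝ (G j '' (convexHull ℝ (s : Set F) ∩ (P i ∩ P j))))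

omit [FiniteDimensional ℝ F] in
theorem IsSeparated.of_refines {G : ι → F → W} {c : ι → ι → ι} {n n' : ℕ}
    {S S' : Finset (Finset F)} (h : IsSeparated I P G c n' S) (hn : n ≤ n')
    (hr : Refines (fun v => (typ I P v).card) n S' S) : IsSeparated I P G c n' S' := by
  intro s hs hsr i hi j hj ⟨y, hy, hyn, hyP⟩
  obtain ⟨t, ht, htr, hst⟩ := hr.exists_face n' hn s hs hsr
  have hsub := inter_subset_inter_left (P i ∩ P j) hst
  exact (h t ht htr i hi j hj ⟨y, hsub hy, hyn, hyP⟩).mono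
    (convexHull_mono (image_mono hsub)) (convexHull_mono (image_mono hsub))

/-- A coincidence `q` would have `c i j` in its type. Its rank is at most `n`, the rank of `y`, so
by the chain condition its type is contained in that of `y`, against `y ∉ P (c i j)`. Hence there
are no coincidences on the compact set in question, and finitely many functionals separate the two
maps there. -/
theorem exists_isSeparated_step (h : IsCutOut I P Λ) (hcpt : ∀ i ∈ I, IsCompact (P i))
    {G : ι → F → W} (hG : ∀ i ∈ I, ContinuousOn (G i) (P i)) {c : ι → ι → ι}
    (hc : ∀ i ∈ I, ∀ j ∈ I, c i j ∈ I)
    (hco : ∀ i ∈ I, ∀ j ∈ I, ∀ y ∈ P i, y ∈ P j → G i y = G j y → y ∈ P (c i j)) (n : ℕ)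
    {S : Finset (Finset F)} (hS : IsComplex S) (hcut : IsCut I Λ S) (hch : IsChainTyped I P S) :
    ∃ S', IsComplex S' ∧ Refines (fun v => (typ I P v).card) n S' S ∧
      IsSeparated I P G c n S' := by
  have hex : ∀ q : Finset F × ι × ι, ∃ Λ' : Finset (F →ᵃ[ℝ] ℝ),
      q.1 ∈ S → (∀ v ∈ q.1, (typ I P v).card ≤ n) → q.2.1 ∈ I → q.2.2 ∈ I →
      (∃ y ∈ convexHull ℝ (q.1 : Set F) ∩ (P q.2.1 ∩ P q.2.2),
        (typ I P y).card = n ∧ y ∉ P (c q.2.1 q.2.2)) →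
      ∀ C ⊆ convexHull ℝ (q.1 : Set F) ∩ (P q.2.1 ∩ P q.2.2), (∀ ℓ ∈ Λ', WeakSign ℓ C) →
        Disjoint (convexHull ℝ (G q.2.1 '' C)) (convexHull ℝ (G q.2.2 '' C)) := by
    rintro ⟨s, i, j⟩
    by_cases hq : s ∈ S ∧ (∀ v ∈ s, (typ I P v).card ≤ n) ∧ i ∈ I ∧ j ∈ I ∧
      (∃ y ∈ convexHull ℝ (s : Set F) ∩ (P i ∩ P j), (typ I P y).card = n ∧ y ∉ P (c i j))
    · obtain ⟨hs, hr, hi, hj, y, hy, hyn, hyP⟩ := hq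
      have hQ : IsCompact (convexHull ℝ (s : Set F) ∩ (P i ∩ P j)) :=
        (s.finite_toSet.isCompact_convexHull (𝕜 := ℝ)).inter ((hcpt i hi).inter (hcpt j hj))
      obtain ⟨Λ', hΛ'⟩ := exists_finset_disjoint hQ
        ((hG i hi).mono fun q hq => hq.2.1) ((hG j hj).mono fun q hq => hq.2.2) (by
          intro q hq heq
          have hqP := hco i hi j hj q hq.2.1 hq.2.2 heq
          obtain ⟨v, hv, hqv⟩ := hcut.exists_typ_eq h hs (fun a ha b hb =>
            hch s hs a (subset_convexHull ℝ _ ha) b (subset_convexHull ℝ _ hb)) hq.1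
          have hqn : (typ I P q).card ≤ n := hqv ▸ hr v hv
          have hmem : c i j ∈ typ I P q := mem_typ.2 ⟨hc i hi j hj, hqP⟩
          have hsub : typ I P q ⊆ typ I P y := by
            rcases hch s hs q hq.1 y hy.1 with h' | h'
            · exact h'
            · rw [Finset.eq_of_subset_of_card_le h' (hyn ▸ hqn)]
          exact hyP (mem_typ.1 (hsub hmem)).2)
      exact ⟨Λ', fun _ _ _ _ _ => hΛ'⟩
    · exact ⟨∅, fun h1 h2 h3 h4 h5 => absurd ⟨h1, h2, h3, h4, h5⟩ hq⟩
  choose Λ' hΛ' using hex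
  obtain ⟨S', hS', hr, hw⟩ := exists_refines_weakSign (fun v => (typ I P v).card) n
    ((S ×ˢ I ×ˢ I).biUnion Λ') hS
  refine ⟨S', hS', hr, fun s hs hsr i hi j hj ⟨y, hy, hyn, hyP⟩ => ?_⟩
  obtain ⟨t, ht, htr, hst⟩ := hr.exists_face n le_rfl s hs hsr
  have hsub := inter_subset_inter_left (P i ∩ P j) hst
  exact hΛ' (t, i, j) ht htr hi hj ⟨y, hsub hy, hyn, hyP⟩ _ hsub fun ℓ hℓ =>
    (hw ℓ (Finset.mem_biUnion.2 ⟨(t, i, j), by simp [ht, hi, hj], hℓ⟩) s hs hsr).mono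
      inter_subset_left

/-- Every complex has a subdivision which is adapted to the family `P` and separates the maps
`G i` away from their coincidences. -/
theorem exists_isSeparated (h : IsCutOut I P Λ) (hcpt : ∀ i ∈ I, IsCompact (P i))
    {G : ι → F → W} (hG : ∀ i ∈ I, ContinuousOn (G i) (P i)) {c : ι → ι → ι}
    (hc : ∀ i ∈ I, ∀ j ∈ I, c i j ∈ I)
    (hco : ∀ i ∈ I, ∀ j ∈ I, ∀ y ∈ P i, y ∈ P j → G i y = G j y → y ∈ P (c i j))
    {S : Finset (Finset F)} (hS : IsComplex S) :
    ∃ S', IsComplex S' ∧ space S' = space S ∧ IsCut I Λ S' ∧ IsChainTyped I P S' ∧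
      ∀ n, IsSeparated I P G c n S' := by
  obtain ⟨S1, hS1, hr1, hcut1⟩ := exists_isCut Λ I hS
  obtain ⟨S2, hS2, hr2, hcut2, hch2⟩ := exists_isChainTyped h hS1 hcut1
  -- Descending induction on the least rank `m` already treated. It starts at `I.card + 1`, a rank
  -- that no point attains.
  have key : ∀ k m, m + k = I.card + 1 → ∃ S', IsComplex S' ∧ space S' = space S ∧ IsCut I Λ S' ∧
      IsChainTyped I P S' ∧ ∀ n, m ≤ n → IsSeparated I P G c n S' := by
    intro k
    induction k with
    | zero =>
      intro m hm
      refine ⟨S2, hS2, hr2.space_eq.trans hr1.space_eq, hcut2, hch2, fun n hn => ?_⟩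
      rintro s - - i - j - ⟨y, -, hyn, -⟩
      have : (typ I P y).card ≤ I.card := Finset.card_le_card (Finset.filter_subset _ _)
      omega
    | succ k ih =>
      intro m hm
      obtain ⟨S3, hS3, hsp, hcut3, hch3, hsep⟩ := ih (m + 1) (by omega)
      obtain ⟨S4, hS4, hr4, hsep4⟩ := exists_isSeparated_step h hcpt hG hc hco m hS3 hcut3 hch3
      refine ⟨S4, hS4, hr4.space_eq.trans hsp, hcut3.of_refines hr4, hch3.of_refines hr4,
        fun n hn => ?_⟩
      rcases hn.eq_or_lt with rfl | hlt
      · exact hsep4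
      · exact (hsep n hlt).of_refines hn hr4
  obtain ⟨S', h1, h2, h3, h4, h5⟩ := key (I.card + 1) 0 (by omega)
  exact ⟨S', h1, h2, h3, h4, fun n => h5 n (Nat.zero_le _)⟩

end Separated

/-! ### Maps linear on the faces of a complex -/

section LinearOn

variable {E V : Type*} [AddCommGroup E] [Module ℝ E] [AddCommGroup V] [Module ℝ V]

/-- The map `h` is linear in barycentric weights on the faces of `S`. -/
def LinearOn (S : Finset (Finset E)) (h : E → V) : Prop :=
  ∀ w : E →₀ ℝ, IsWeight w → w.support ∈ S → h (lc id w) = lc h w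

theorem mem_space_of_mem {S : Finset (Finset E)} (hS : IsComplex S) {s : Finset E} (hs : s ∈ S)
    {v : E} (hv : v ∈ s) : v ∈ space S :=
  hS.mem_space_iff.2 ⟨s, hs, subset_convexHull ℝ _ hv⟩

/-- Pushing weights forward by `h` and back by a left inverse `r` are mutually inverse on weights
carried by faces. Uniqueness of weights, the underlying set and linearity of `r` are all transported
this way. -/
theorem IsComplex.image {S : Finset (Finset E)} (hS : IsComplex S) {h : E → V}
    (hlin : LinearOn S h) (hinj : InjOn h (space S)) :
    IsComplex (S.image (Finset.image h)) ∧ space (S.image (Finset.image h)) = h '' space S ∧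
      ∀ r : V → E, (∀ x ∈ space S, r (h x) = x) → LinearOn (S.image (Finset.image h)) r := by
  have key : ∀ r : V → E, (∀ x ∈ space S, r (h x) = x) → ∀ w : V →₀ ℝ, IsWeight w →
      w.support ∈ S.image (Finset.image h) → (w.mapDomain r).support ∈ S ∧
        IsWeight (w.mapDomain r) ∧ (w.mapDomain r).mapDomain h = w ∧
        lc id w = h (lc id (w.mapDomain r)) := by
    intro r hr w hw hs
    obtain ⟨s, hsS, hsw⟩ := Finset.mem_image.1 hs
    have h1 : (w.mapDomain r).support ∈ S := by
      rw [hw.support_mapDomain, ← hsw, Finset.image_image]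
      convert hsS
      refine (Finset.image_congr (g := id) fun v hv => ?_).trans Finset.image_id
      exact hr v (mem_space_of_mem hS hsS hv)
    have h2 : (w.mapDomain r).mapDomain h = w := by
      rw [← Finsupp.mapDomain_comp]
      refine (Finsupp.mapDomain_congr (g := id) fun y hy => ?_).trans Finsupp.mapDomain_id
      rw [← hsw] at hy
      obtain ⟨v, hv, rfl⟩ := Finset.mem_image.1 hy
      simp [hr v (mem_space_of_mem hS hsS hv)]
    refine ⟨h1, hw.mapDomain r, h2, ?_⟩
    rw [hlin _ (hw.mapDomain r) h1]
    conv_lhs => rw [← h2]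
    rw [lc_mapDomain]
    rfl
  have hr0 : ∀ x ∈ space S, Function.invFunOn h (space S) (h x) = x := fun x hx =>
    hinj.leftInvOn_invFunOn hx
  refine ⟨⟨?_, ?_⟩, ?_, ?_⟩
  · intro s hs t hts
    obtain ⟨s, hsS, rfl⟩ := Finset.mem_image.1 hs
    obtain ⟨u, hu, rfl⟩ := Finset.subset_image_iff.1 hts
    exact Finset.mem_image_of_mem _ (hS.down s hsS u hu)
  · intro w w' hw hw' hs hs' he
    obtain ⟨h1, h2, h3, h4⟩ := key _ hr0 w hw hs
    obtain ⟨h1', h2', h3', h4'⟩ := key _ hr0 w' hw' hs'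
    rw [h4, h4'] at he
    rw [← h3, ← h3', hS.uniq _ _ h2 h2' h1 h1' (hinj ⟨_, h2, h1, rfl⟩ ⟨_, h2', h1', rfl⟩ he)]
  · ext y
    constructor
    · rintro ⟨w, hw, hs, rfl⟩
      obtain ⟨h1, h2, h3, h4⟩ := key _ hr0 w hw hs
      exact ⟨_, ⟨_, h2, h1, rfl⟩, h4.symm⟩
    · rintro ⟨_, ⟨w, hw, hs, rfl⟩, rfl⟩
      refine ⟨w.mapDomain h, hw.mapDomain h, ?_, ?_⟩
      · rw [hw.support_mapDomain]
        exact Finset.mem_image_of_mem _ hs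
      · rw [hlin w hw hs, lc_mapDomain]
        rfl
  · intro r hr w hw hs
    obtain ⟨h1, h2, h3, h4⟩ := key r hr w hw hs
    rw [h4, hr _ ⟨_, h2, h1, rfl⟩, lc_mapDomain]
    rfl

theorem IsComplex.powerset {S : Finset (Finset E)} (hS : IsComplex S) {s : Finset E}
    (hs : s ∈ S) : IsComplex s.powerset ∧ space s.powerset = convexHull ℝ (s : Set E) := by
  refine ⟨⟨fun t ht u hu => ?_, fun w w' hw hw' h h' => ?_⟩, ?_⟩
  · rw [Finset.mem_powerset] at ht ⊢
    exact hu.trans ht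
  · rw [Finset.mem_powerset] at h h'
    exact hS.uniq w w' hw hw' (hS.down s hs _ h) (hS.down s hs _ h')
  · ext x
    rw [mem_convexHull_iff_weight]
    simp only [space, Finset.mem_powerset]
    rfl

/-- The map `f` agrees with an affine map on every face of `S`. -/
def AffineOnFaces (S : Finset (Finset E)) (f : E → V) : Prop :=
  ∀ s ∈ S, ∃ A : E →ᵃ[ℝ] V, ∀ x ∈ convexHull ℝ (s : Set E), f x = A x

theorem AffineOnFaces.lc_eq {S : Finset (Finset E)} {f : E → V} (hf : AffineOnFaces S f)
    {s : Finset E} (hs : s ∈ S) {w : E →₀ ℝ} (hw : IsWeight w)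
    (hws : (w.support : Set E) ⊆ convexHull ℝ (s : Set E)) : f (lc id w) = lc f w := by
  obtain ⟨A, hA⟩ := hf s hs
  have hmem : lc id w ∈ convexHull ℝ (s : Set E) := by
    have := hw.lc_mem_convexHull subset_rfl id
    rw [image_id] at this
    exact convexHull_min hws (convex_convexHull ℝ _) this
  rw [hA _ hmem, affineMap_lc A hw.mass]
  exact lc_congr fun v hv => (hA v (hws hv)).symm

theorem LinearOn.affineOnFaces {S : Finset (Finset E)} (hS : IsComplex S) {f : E → V}
    (hf : LinearOn S f) : AffineOnFaces S f := by
  intro s hs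
  obtain ⟨A, hA⟩ := exists_affineMap_eq (hS.affineIndependent hs) f
  refine ⟨A, fun x hx => ?_⟩
  obtain ⟨w, hw, hws, rfl⟩ := mem_convexHull_iff_weight.1 hx
  rw [hf w hw (hS.down s hs _ hws), affineMap_lc A hw.mass]
  exact lc_congr fun v hv => (hA v (hws hv)).symm

/-- Properties of the image of a face under a map which is affine and injective on it. -/
theorem AffineOnFaces.image_face {S : Finset (Finset E)} (hS : IsComplex S) {f : E → V}
    (hf : AffineOnFaces S f) {s : Finset E} (hs : s ∈ S)
    (hinj : InjOn f (convexHull ℝ (s : Set E))) :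
    AffineIndependent ℝ ((↑) : s.image f → V) ∧
    f '' convexHull ℝ (s : Set E) = convexHull ℝ (s.image f : Set V) ∧
    ∃ A : V →ᵃ[ℝ] E, ∀ x ∈ convexHull ℝ (s : Set E), A (f x) = x := by
  obtain ⟨hc, hsp⟩ := hS.powerset hs
  have hlin : LinearOn s.powerset f := fun w hw hws => hf.lc_eq hs hw
    ((Finset.coe_subset.2 (Finset.mem_powerset.1 hws)).trans (subset_convexHull ℝ _))
  obtain ⟨h1, h2, h3⟩ := hc.image hlin (by rwa [hsp])
  have hmem : s.image f ∈ s.powerset.image (Finset.image f) :=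
    Finset.mem_image_of_mem _ (Finset.mem_powerset.2 subset_rfl)
  have hr := h3 (Function.invFunOn f (convexHull ℝ (s : Set E)))
    (by rw [hsp]; exact fun x hx => hinj.leftInvOn_invFunOn hx)
  obtain ⟨A, hA⟩ := hr.affineOnFaces h1 _ hmem
  have himg : f '' convexHull ℝ (s : Set E) = convexHull ℝ (s.image f : Set V) := by
    obtain ⟨B, hB⟩ := hf s hs
    rw [image_congr hB, B.image_convexHull, Finset.coe_image]
    congr 1
    exact image_congr fun x hx => (hB x (subset_convexHull ℝ _ hx)).symm
  refine ⟨h1.affineIndependent hmem, himg, A, fun x hx => ?_⟩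
  rw [← hA _ (himg ▸ mem_image_of_mem f hx)]
  exact hinj.leftInvOn_invFunOn hx

end LinearOn

/-! ### Lifting a triangulation of the target -/

section Pullback

variable {E F : Type*} [AddCommGroup E] [Module ℝ E] [AddCommGroup F] [Module ℝ F]

/-- The inverse of `f` on the simplex spanned by `δ`. -/
noncomputable def sheet (f : E → F) (δ : Finset E) : F → E :=
  Function.invFunOn f (convexHull ℝ (δ : Set E))

/-- The image under `f` of the simplex spanned by `δ`. -/
def imageFace (f : E → F) (δ : Finset E) : Set F := f '' convexHull ℝ (δ : Set E)

/-- The lifts of the faces of `L` to the faces of `K`. -/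
noncomputable def pullback (K : Finset (Finset E)) (L : Finset (Finset F)) (f : E → F) :
    Finset (Finset E) :=
  ((K ×ˢ L).filter (fun p => (p.2 : Set F) ⊆ imageFace f p.1)).image
    (fun p => p.2.image (sheet f p.1))

omit [AddCommGroup F] [Module ℝ F] in
theorem mem_pullback {K : Finset (Finset E)} {L : Finset (Finset F)} {f : E → F}
    (hinj : ∀ δ ∈ K, InjOn f (convexHull ℝ (δ : Set E))) {u : Finset E} :
    u ∈ pullback K L f ↔
      ∃ δ ∈ K, (u : Set E) ⊆ convexHull ℝ (δ : Set E) ∧ u.image f ∈ L := by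
  simp only [pullback, Finset.mem_image, Finset.mem_filter, Finset.mem_product, Prod.exists]
  constructor
  · rintro ⟨δ, β, ⟨⟨hδ, hβ⟩, hsub⟩, rfl⟩
    refine ⟨δ, hδ, ?_, ?_⟩
    · rw [Finset.coe_image]
      rintro _ ⟨v, hv, rfl⟩
      exact Function.invFunOn_mem (hsub hv)
    · rw [Finset.image_image]
      convert hβ
      refine (Finset.image_congr (g := id) fun v hv => ?_).trans Finset.image_id
      exact Function.invFunOn_eq (hsub hv)
  · rintro ⟨δ, hδ, hu, huL⟩
    refine ⟨δ, u.image f, ⟨⟨hδ, huL⟩, ?_⟩, ?_⟩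
    · rw [Finset.coe_image]
      exact image_mono hu
    · rw [Finset.image_image]
      refine (Finset.image_congr (g := id) fun v hv => ?_).trans Finset.image_id
      exact (hinj δ hδ).leftInvOn_invFunOn (hu hv)

variable {K : Finset (Finset E)} {L : Finset (Finset F)} {f : E → F}
  {Λ : Finset E → Finset (F →ᵃ[ℝ] ℝ)}

theorem pullback_linearOn (hf : AffineOnFaces K f)
    (hinj : ∀ δ ∈ K, InjOn f (convexHull ℝ (δ : Set E))) : LinearOn (pullback K L f) f := by
  intro w hw hs
  obtain ⟨δ, hδ, hsub, -⟩ := (mem_pullback hinj).1 hs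
  exact hf.lc_eq hδ hw hsub

/-- Two weight systems of a point have the same push-forward in `L`. The point lies in the simplex
of `δ ∩ δ'`, so the cut condition places all vertices of the push-forward in its image. Both systems
are therefore the lift of the push-forward by `sheet f (δ ∩ δ')`. -/
theorem pullback_isComplex (hK : IsComplex K) (hL : IsComplex L) (hf : AffineOnFaces K f)
    (hinj : ∀ δ ∈ K, InjOn f (convexHull ℝ (δ : Set E))) (hΛ : IsCutOut K (imageFace f) Λ)
    (hcut : IsCut K Λ L) : IsComplex (pullback K L f) := by
  constructor
  · intro s hs t hts
    rw [mem_pullback hinj] at hs ⊢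
    obtain ⟨δ, hδ, hsub, hsL⟩ := hs
    exact ⟨δ, hδ, (Finset.coe_subset.2 hts).trans hsub, hL.down _ hsL _ (Finset.image_mono _ hts)⟩
  · intro w w' hw hw' hs hs' he
    have hlin := pullback_linearOn (L := L) hf hinj w hw hs
    have hlin' := pullback_linearOn (L := L) hf hinj w' hw' hs'
    obtain ⟨δ, hδ, hsub, hsL⟩ := (mem_pullback hinj).1 hs
    obtain ⟨δ', hδ', hsub', hsL'⟩ := (mem_pullback hinj).1 hs'
    have hcomp : ∀ v : E →₀ ℝ, lc id (v.mapDomain f) = lc f v := fun v => by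
      rw [lc_mapDomain]; rfl
    have hm : w.mapDomain f = w'.mapDomain f := by
      refine hL.uniq _ _ (hw.mapDomain f) (hw'.mapDomain f) ?_ ?_ ?_
      · rwa [hw.support_mapDomain]
      · rwa [hw'.support_mapDomain]
      · rw [hcomp, hcomp, ← hlin, ← hlin', he]
    have hmemx : ∀ {v : E →₀ ℝ} {δ : Finset E}, IsWeight v →
        (v.support : Set E) ⊆ convexHull ℝ (δ : Set E) →
        lc id v ∈ convexHull ℝ (δ : Set E) := by
      intro v δ hv hvs
      have := hv.lc_mem_convexHull subset_rfl id
      rw [image_id] at this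
      exact convexHull_min hvs (convex_convexHull ℝ _) this
    have hx := hK.convexHull_inter hδ hδ' (hmemx hw hsub) (he ▸ hmemx hw' hsub')
    have hε : δ ∩ δ' ∈ K := hK.down δ hδ _ Finset.inter_subset_left
    have hfx : lc id (w.mapDomain f) ∈ imageFace f (δ ∩ δ') := by
      rw [hcomp, ← hlin]
      exact mem_image_of_mem f hx
    have hvert := (hcut.mem_iff hΛ hε (hw.mapDomain f) (s := (w.mapDomain f).support)
      (by rwa [hw.support_mapDomain]) subset_rfl).1 hfx
    have hincl : convexHull ℝ ((δ ∩ δ' : Finset E) : Set E) ⊆ convexHull ℝ (δ : Set E) :=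
      convexHull_mono (by simp)
    have hincl' : convexHull ℝ ((δ ∩ δ' : Finset E) : Set E) ⊆ convexHull ℝ (δ' : Set E) :=
      convexHull_mono (by simp)
    have hr : ∀ (v : E →₀ ℝ) (δ₁ : Finset E), δ₁ ∈ K → IsWeight v →
        v.mapDomain f = w.mapDomain f → (v.support : Set E) ⊆ convexHull ℝ (δ₁ : Set E) →
        convexHull ℝ ((δ ∩ δ' : Finset E) : Set E) ⊆ convexHull ℝ (δ₁ : Set E) →
        (w.mapDomain f).mapDomain (sheet f (δ ∩ δ')) = v := by
      intro v δ₁ hδ₁ hv hvm hvs hinc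
      rw [← hvm, ← Finsupp.mapDomain_comp]
      refine (Finsupp.mapDomain_congr (g := id) fun u hu => ?_).trans Finsupp.mapDomain_id
      obtain ⟨p, hp, hpu⟩ := hvert (f u) (by
        rw [← hvm, hv.support_mapDomain]; exact Finset.mem_image_of_mem f hu)
      have hup : u = p := hinj δ₁ hδ₁ (hvs hu) (hinc hp) hpu.symm
      subst hup
      exact (hinj _ hε).leftInvOn_invFunOn hp
    rw [← hr w δ hδ hw rfl hsub hincl, ← hr w' δ' hδ' hw' hm.symm hsub' hincl']

/-- For `x` in the simplex of `δ`, the cut condition puts the vertices carrying `f x` into the image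
of that simplex. They lift by `sheet f δ`, and injectivity of `f` identifies the lifted point with
`x`. -/
theorem pullback_space (hK : IsComplex K) (hf : AffineOnFaces K f)
    (hinj : ∀ δ ∈ K, InjOn f (convexHull ℝ (δ : Set E))) (hΛ : IsCutOut K (imageFace f) Λ)
    (hcut : IsCut K Λ L) (hmaps : MapsTo f (space K) (space L)) :
    space (pullback K L f) = space K := by
  ext x
  constructor
  · rintro ⟨w, hw, hs, rfl⟩
    obtain ⟨δ, hδ, hsub, hsL⟩ := (mem_pullback hinj).1 hs
    have := hw.lc_mem_convexHull subset_rfl id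
    rw [image_id] at this
    exact hK.mem_space_iff.2 ⟨δ, hδ, convexHull_min hsub (convex_convexHull ℝ _) this⟩
  · intro hx
    obtain ⟨ω, hω, hωL, hωx⟩ := hmaps hx
    obtain ⟨δ, hδ, hxδ⟩ := hK.mem_space_iff.1 hx
    have hvert : ∀ v ∈ ω.support, v ∈ imageFace f δ := (hcut.mem_iff hΛ hδ hω hωL subset_rfl).1
      (hωx ▸ mem_image_of_mem f hxδ)
    have hsup := hω.support_mapDomain (sheet f δ)
    have hsub : ((ω.mapDomain (sheet f δ)).support : Set E) ⊆ convexHull ℝ (δ : Set E) := by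
      rw [hsup, Finset.coe_image]
      rintro _ ⟨v, hv, rfl⟩
      exact Function.invFunOn_mem (hvert v hv)
    have hw := hω.mapDomain (sheet f δ)
    refine ⟨ω.mapDomain (sheet f δ), hw, ?_, ?_⟩
    · refine (mem_pullback hinj).2 ⟨δ, hδ, hsub, ?_⟩
      rw [hsup, Finset.image_image]
      convert hωL
      refine (Finset.image_congr (g := id) fun v hv => ?_).trans Finset.image_id
      exact Function.invFunOn_eq (hvert v hv)
    · refine hinj δ hδ ?_ hxδ ?_
      · have := hw.lc_mem_convexHull subset_rfl id
        rw [image_id] at this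
        exact convexHull_min hsub (convex_convexHull ℝ _) this
      · rw [hf.lc_eq hδ hw hsub, lc_mapDomain, ← hωx]
        exact lc_congr fun v hv => Function.invFunOn_eq (hvert v hv)

end Pullback

/-! ### Ordered lifts -/

section Ordered

variable {E F W : Type*} [AddCommGroup E] [Module ℝ E] [AddCommGroup F] [Module ℝ F]
  [AddCommGroup W] [Module ℝ W]

/-- A triangulation on which `f` is simplicial, with the vertices ordered by `o ∘ f` so that
two lifts of a simplex coincide in an initial face, and disjoint lifts of a simplex are separated
by `g`. -/
structure IsOrderedLift (K : Finset (Finset E)) (f : E → F) (g : E → W) (o : F → ℕ ×ₗ ℕ) :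
    Prop where
  complex : IsComplex K
  linear : LinearOn K f
  push : ∀ w w' : E →₀ ℝ, IsWeight w → IsWeight w' → w.support ∈ K → w'.support ∈ K →
    lc f w = lc f w' → w.mapDomain f = w'.mapDomain f
  ordInj : ∀ s ∈ K, InjOn (fun u => o (f u)) (s : Set E)
  initial : ∀ s ∈ K, ∀ s' ∈ K, s.image f = s'.image f →
    ∀ u ∈ s, u ∈ s' → ∀ v ∈ s, v ∉ s' → o (f u) < o (f v)
  disj : ∀ s ∈ K, ∀ s' ∈ K, s.image f = s'.image f → Disjoint s s' →
    Disjoint (convexHull ℝ (g '' convexHull ℝ (s : Set E)))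
      (convexHull ℝ (g '' convexHull ℝ (s' : Set E)))

end Ordered

/-! ### Existence of ordered lifts -/

section Existence

variable {E F W : Type*} [NormedAddCommGroup E] [NormedSpace ℝ E] [FiniteDimensional ℝ E]
  [NormedAddCommGroup F] [NormedSpace ℝ F] [FiniteDimensional ℝ F]
  [NormedAddCommGroup W] [NormedSpace ℝ W]

/-- The separation theorem is applied to the images of the simplices `δ`, the maps `g ∘ sheet f δ`
and `c δ δ' = δ ∩ δ'`; the resulting subdivision is then pulled back. -/
theorem exists_isOrderedLift {K₀ : Finset (Finset E)} {L₀ : Finset (Finset F)} {f : E → F}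
    {g : E → W} (hK : IsComplex K₀) (hL : IsComplex L₀) (hf : AffineOnFaces K₀ f)
    (hinj : ∀ δ ∈ K₀, InjOn f (convexHull ℝ (δ : Set E)))
    (hmaps : MapsTo f (space K₀) (space L₀)) (hg : ContinuousOn g (space K₀))
    (hfib : ∀ x ∈ space K₀, ∀ y ∈ space K₀, f x = f y → g x = g y → x = y) :
    ∃ K o, IsOrderedLift K f g o ∧ space K = space K₀ ∧
      ∀ u ∈ K, ∃ δ ∈ K₀, convexHull ℝ (u : Set E) ⊆ convexHull ℝ (δ : Set E) := by
  have hface : ∀ δ ∈ K₀, ∃ Λ : Finset (F →ᵃ[ℝ] ℝ), imageFace f δ = {x | ∀ ℓ ∈ Λ, ℓ x ≤ 0} := by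
    intro δ hδ
    obtain ⟨h1, h2, -⟩ := hf.image_face hK hδ (hinj δ hδ)
    obtain ⟨Λ, hΛ⟩ := exists_halfspaces h1
    exact ⟨Λ, h2.trans hΛ⟩
  choose! Λ hΛ using hface
  have hcutout : IsCutOut K₀ (imageFace f) Λ := hΛ
  have hsub : ∀ δ ∈ K₀, convexHull ℝ (δ : Set E) ⊆ space K₀ := fun δ hδ x hx =>
    hK.mem_space_iff.2 ⟨δ, hδ, hx⟩
  have hfc : ∀ δ ∈ K₀, ContinuousOn f (convexHull ℝ (δ : Set E)) := fun δ hδ => by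
    obtain ⟨A, hA⟩ := hf δ hδ
    exact (AffineMap.continuous_of_finiteDimensional A).continuousOn.congr hA
  have hcpt : ∀ δ ∈ K₀, IsCompact (imageFace f δ) := fun δ hδ =>
    (δ.finite_toSet.isCompact_convexHull (𝕜 := ℝ)).image_of_continuousOn (hfc δ hδ)
  have hsheet : ∀ δ ∈ K₀, ∀ x ∈ convexHull ℝ (δ : Set E), sheet f δ (f x) = x :=
    fun δ hδ x hx => (hinj δ hδ).leftInvOn_invFunOn hx
  have hG : ∀ δ ∈ K₀, ContinuousOn (fun y => g (sheet f δ y)) (imageFace f δ) := by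
    intro δ hδ
    obtain ⟨-, -, A, hA⟩ := hf.image_face hK hδ (hinj δ hδ)
    have hs : ContinuousOn (sheet f δ) (imageFace f δ) := by
      refine (AffineMap.continuous_of_finiteDimensional A).continuousOn.congr ?_
      rintro _ ⟨x, hx, rfl⟩
      rw [hsheet δ hδ x hx, hA x hx]
    refine hg.comp hs ?_
    rintro _ ⟨x, hx, rfl⟩
    rw [hsheet δ hδ x hx]
    exact hsub δ hδ hx
  have hinter : ∀ δ ∈ K₀, ∀ δ' ∈ K₀, δ ∩ δ' ∈ K₀ := fun δ hδ δ' _ =>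
    hK.down δ hδ _ Finset.inter_subset_left
  obtain ⟨L, hL', hspL, hcut, hch, hsep⟩ := exists_isSeparated hcutout hcpt hG
    (c := fun δ δ' => δ ∩ δ') hinter (by
      rintro δ hδ δ' hδ' _ ⟨x, hx, rfl⟩ ⟨y, hy, hxy⟩ heq
      rw [hsheet δ hδ x hx, ← hxy, hsheet δ' hδ' y hy] at heq
      have hxy' := hfib x (hsub δ hδ hx) y (hsub δ' hδ' hy) hxy.symm heq
      subst hxy'
      exact mem_image_of_mem f (hK.convexHull_inter hδ hδ' hx hy)) hL
  have hpb : ∀ {u}, u ∈ pullback K₀ L f ↔ _ := mem_pullback hinj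
  have hincl : ∀ δ δ' : Finset E, convexHull ℝ ((δ ∩ δ' : Finset E) : Set E) ⊆
      convexHull ℝ (δ : Set E) := fun δ δ' => convexHull_mono (by simp)
  have hincl' : ∀ δ δ' : Finset E, convexHull ℝ ((δ ∩ δ' : Finset E) : Set E) ⊆
      convexHull ℝ (δ' : Set E) := fun δ δ' => convexHull_mono (by simp)
  let T := typ K₀ (imageFace f)
  obtain ⟨idx, hidx⟩ := countable_iff_exists_injOn.1 (L.biUnion id).finite_toSet.countable
  -- Larger rank comes first, and the index breaks ties. Ranks are at most `K₀.card`, so the natural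
  -- subtraction is not truncated.
  let o : F → ℕ ×ₗ ℕ := fun y => toLex (K₀.card - (T y).card, idx y)
  have hTle : ∀ y, (T y).card ≤ K₀.card := fun y => Finset.card_le_card (Finset.filter_subset _ _)
  refine ⟨pullback K₀ L f, o, ⟨pullback_isComplex hK hL' hf hinj hcutout hcut,
    pullback_linearOn hf hinj, ?_, ?_, ?_, ?_⟩,
    pullback_space hK hf hinj hcutout hcut (hspL ▸ hmaps), ?_⟩
  · intro w w' hw hw' hs hs' he
    obtain ⟨-, -, -, hsL⟩ := hpb.1 hs
    obtain ⟨-, -, -, hsL'⟩ := hpb.1 hs'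
    refine hL'.uniq _ _ (hw.mapDomain f) (hw'.mapDomain f) ?_ ?_ ?_
    · rwa [hw.support_mapDomain]
    · rwa [hw'.support_mapDomain]
    · rw [lc_mapDomain, lc_mapDomain]
      exact he
  · intro s hs u hu v hv huv
    obtain ⟨δ, hδ, hsδ, hsL⟩ := hpb.1 hs
    have h2 : idx (f u) = idx (f v) := congrArg (fun p => (ofLex p).2) huv
    refine hinj δ hδ (hsδ hu) (hsδ hv) (hidx ?_ ?_ h2) <;>
      exact Finset.mem_coe.2 (Finset.mem_biUnion.2 ⟨_, hsL, Finset.mem_image_of_mem f ‹_›⟩)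
  · intro s hs s' hs' hss u hu hu' v hv hv'
    obtain ⟨δ, hδ, hsδ, hsL⟩ := hpb.1 hs
    obtain ⟨δ', hδ', hsδ', hsL'⟩ := hpb.1 hs'
    have h1 : δ ∩ δ' ∈ T (f u) := mem_typ.2 ⟨hinter δ hδ δ' hδ',
      mem_image_of_mem f (hK.convexHull_inter hδ hδ' (hsδ hu) (hsδ' hu'))⟩
    have h2 : δ ∩ δ' ∉ T (f v) := by
      intro hmem
      obtain ⟨p, hp, hpv⟩ := (mem_typ.1 hmem).2
      have hpv' := hinj δ hδ (hincl _ _ hp) (hsδ hv) hpv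
      subst hpv'
      have : f p ∈ s'.image f := hss ▸ Finset.mem_image_of_mem f hv
      obtain ⟨q, hq, hqp⟩ := Finset.mem_image.1 this
      have := hinj δ' hδ' (hsδ' hq) (hincl' _ _ hp) hqp
      exact hv' (this ▸ hq)
    -- `δ ∩ δ'` is in the type of `f u` but not in that of `f v`, so the chain condition leaves only
    -- this inclusion, and it is strict.
    have hsubT : T (f v) ⊆ T (f u) := by
      refine (hch _ hsL (f u) ?_ (f v) ?_).resolve_left fun h => h2 (h h1)
      · exact subset_convexHull ℝ _ (Finset.mem_coe.2 (Finset.mem_image_of_mem f hu))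
      · exact subset_convexHull ℝ _ (Finset.mem_coe.2 (Finset.mem_image_of_mem f hv))
    have hlt : (T (f v)).card < (T (f u)).card :=
      Finset.card_lt_card ⟨hsubT, fun h => h2 (h h1)⟩
    have := hTle (f u)
    rw [Prod.Lex.lt_iff]
    left
    simp only [o, ofLex_toLex]
    omega
  · intro s hs s' hs' hss hdis
    obtain ⟨δ, hδ, hsδ, hsL⟩ := hpb.1 hs
    obtain ⟨δ', hδ', hsδ', hsL'⟩ := hpb.1 hs'
    rcases s.eq_empty_or_nonempty with rfl | hne
    · simp
    -- Let `u₀` and `u₁` be the lifts of a vertex of maximal rank. If their common image came from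
    -- the simplex of `δ ∩ δ'`, injectivity would give `u₀ = u₁`, against disjointness. So
    -- separation at this rank applies.
    obtain ⟨u₀, hu₀, hmax⟩ := s.exists_max_image (fun u => (T (f u)).card) hne
    obtain ⟨u₁, hu₁, hu₁₀⟩ := Finset.mem_image.1 (hss ▸ Finset.mem_image_of_mem f hu₀)
    have himg : ((s.image f : Finset F) : Set F) ⊆ imageFace f δ := by
      rw [Finset.coe_image]; exact image_mono hsδ
    have himg' : ((s.image f : Finset F) : Set F) ⊆ imageFace f δ' := by
      rw [hss, Finset.coe_image]; exact image_mono hsδ'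
    have hC := convexHull_min himg (hcutout.convex hδ)
    have hC' := convexHull_min himg' (hcutout.convex hδ')
    have hsepd := hsep (T (f u₀)).card (s.image f) hsL (by
      intro v hv
      obtain ⟨u, hu, rfl⟩ := Finset.mem_image.1 hv
      exact hmax u hu) δ hδ δ' hδ' ⟨f u₀, ⟨subset_convexHull ℝ _
        (Finset.mem_coe.2 (Finset.mem_image_of_mem f hu₀)), mem_image_of_mem f (hsδ hu₀),
        hu₁₀ ▸ mem_image_of_mem f (hsδ' hu₁)⟩, rfl, by
        rintro ⟨p, hp, hpu⟩
        have e1 := hinj δ hδ (hincl _ _ hp) (hsδ hu₀) hpu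
        have e2 := hinj δ' hδ' (hincl' _ _ hp) (hsδ' hu₁) (hpu.trans hu₁₀.symm)
        exact Finset.disjoint_left.1 hdis hu₀ (e1 ▸ e2 ▸ hu₁)⟩
    have hfs : ∀ (t δ₁ : Finset E), δ₁ ∈ K₀ → t ∈ pullback K₀ L f →
        (t : Set E) ⊆ convexHull ℝ (δ₁ : Set E) → t.image f = s.image f →
        g '' convexHull ℝ (t : Set E) ⊆ (fun y => g (sheet f δ₁ y)) ''
          (convexHull ℝ ((s.image f : Finset F) : Set F) ∩ (imageFace f δ ∩ imageFace f δ')) := by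
      rintro t δ₁ hδ₁ ht htδ hts _ ⟨x, hx, rfl⟩
      have hfx : f x ∈ convexHull ℝ ((s.image f : Finset F) : Set F) := by
        obtain ⟨w, hw, hwt, rfl⟩ := mem_convexHull_iff_weight.1 hx
        rw [hf.lc_eq hδ₁ hw ((Finset.coe_subset.2 hwt).trans htδ), ← hts, Finset.coe_image]
        exact hw.lc_mem_convexHull hwt f
      refine ⟨f x, ⟨hfx, hC hfx, hC' hfx⟩, ?_⟩
      simp only
      rw [hsheet δ₁ hδ₁ x (convexHull_min htδ (convex_convexHull ℝ _) hx)]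
    exact hsepd.mono (convexHull_mono (hfs s δ hδ hs hsδ rfl))
      (convexHull_mono (hfs s' δ' hδ' hs' hsδ' hss.symm))
  · intro u hu
    obtain ⟨δ, hδ, hsub, -⟩ := hpb.1 hu
    exact ⟨δ, hδ, convexHull_min hsub (convex_convexHull ℝ _)⟩

end Existence

/-! ### Extracting the first units of mass -/

section Extraction

variable {E α : Type*} [LinearOrder α]

/-- The mass of `w` on the vertices preceding `c` in the order given by `κ`. -/
noncomputable def massBelow (κ : E → α) (w : E →₀ ℝ) (c : α) : ℝ :=
  lc (fun u => if κ u < c then (1 : ℝ) else 0) w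

/-- The part of `w` consisting of its first `t` units of mass, in the order given by `κ`. -/
noncomputable def extract (κ : E → α) (t : ℝ) (w : E →₀ ℝ) : E →₀ ℝ :=
  Finsupp.onFinset w.support
    (fun u => min t (massBelow κ w (κ u) + w u) - min t (massBelow κ w (κ u)))
    (fun u hu => Finsupp.mem_support_iff.2 fun h => hu (by rw [h, add_zero, sub_self]))

/-- With the masses laid end to end in the order given by `κ`, the vertex `u` occupies an interval
starting at `massBelow κ w (κ u)`; the formula measures its part below `t`. -/
theorem extract_apply (κ : E → α) (t : ℝ) (w : E →₀ ℝ) (u : E) :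
    extract κ t w u = min t (massBelow κ w (κ u) + w u) - min t (massBelow κ w (κ u)) := rfl

theorem support_extract (κ : E → α) (t : ℝ) (w : E →₀ ℝ) :
    (extract κ t w).support ⊆ w.support := Finsupp.support_onFinset_subset

theorem massBelow_eq_sum (κ : E → α) (w : E →₀ ℝ) (c : α) :
    massBelow κ w c = ∑ u ∈ w.support.filter (fun u => κ u < c), w u := by
  rw [massBelow, lc_eq_sum subset_rfl, Finset.sum_filter]
  exact Finset.sum_congr rfl fun u _ => by simp

theorem massBelow_nonneg {κ : E → α} {w : E →₀ ℝ} (hw : IsWeight w) (c : α) :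
    0 ≤ massBelow κ w c := by
  rw [massBelow_eq_sum]
  exact Finset.sum_nonneg fun u _ => hw.nonneg u

theorem IsWeight.sum_eq_one {w : E →₀ ℝ} (hw : IsWeight w) : ∑ u ∈ w.support, w u = 1 := by
  have := hw.mass
  rw [lc_eq_sum subset_rfl] at this
  simpa using this

theorem massBelow_add_le {κ : E → α} {w : E →₀ ℝ} (hw : IsWeight w) {u : E} {s : Finset E}
    (hs : ∀ v, v ∈ w.support → κ v ≤ κ u → v ∈ s) :
    massBelow κ w (κ u) + w u ≤ ∑ v ∈ s, w v := by
  rw [massBelow_eq_sum]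
  by_cases hu : u ∈ w.support
  · rw [add_comm, ← Finset.sum_insert (by simp)]
    refine Finset.sum_le_sum_of_subset_of_nonneg ?_ fun v _ _ => hw.nonneg v
    intro v hv
    rcases Finset.mem_insert.1 hv with rfl | hv
    · exact hs v hu le_rfl
    · exact hs v (Finset.mem_filter.1 hv).1 (Finset.mem_filter.1 hv).2.le
  · rw [Finsupp.notMem_support_iff.1 hu, add_zero]
    refine Finset.sum_le_sum_of_subset_of_nonneg ?_ fun v _ _ => hw.nonneg v
    exact fun v hv => hs v (Finset.mem_filter.1 hv).1 (Finset.mem_filter.1 hv).2.le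

theorem extract_nonneg {κ : E → α} {t : ℝ} {w : E →₀ ℝ} (hw : IsWeight w) (u : E) :
    0 ≤ extract κ t w u := by
  rw [extract_apply, sub_nonneg]
  exact min_le_min_left _ (le_add_of_nonneg_right (hw.nonneg u))

theorem extract_le {κ : E → α} {t : ℝ} {w : E →₀ ℝ} (hw : IsWeight w) (u : E) :
    extract κ t w u ≤ w u := by
  rw [extract_apply]
  have := hw.nonneg u
  rcases le_total t (massBelow κ w (κ u)) with h | h
  · rw [min_eq_left h, min_eq_left (by linarith)]; linarith
  · rw [min_eq_right h]
    have := min_le_right t (massBelow κ w (κ u) + w u)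
    linarith

theorem extract_zero {κ : E → α} {w : E →₀ ℝ} (hw : IsWeight w) : extract κ 0 w = 0 := by
  ext u
  have h1 := massBelow_nonneg (κ := κ) hw (κ u)
  rw [extract_apply, min_eq_left h1, min_eq_left (add_nonneg h1 (hw.nonneg u))]
  simp

theorem extract_one {κ : E → α} {w : E →₀ ℝ} (hw : IsWeight w) : extract κ 1 w = w := by
  ext u
  have h1 : massBelow κ w (κ u) + w u ≤ 1 :=
    (massBelow_add_le hw (s := w.support) fun v hv _ => hv).trans hw.sum_eq_one.le
  have := hw.nonneg u
  rw [extract_apply, min_eq_right h1, min_eq_right (by linarith)]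
  ring

/-- If `u` is not exhausted, `t` falls before the end of its interval, hence before the beginning of
the interval of any later vertex. -/
theorem extract_eq_zero_of_lt {κ : E → α} {t : ℝ} {w : E →₀ ℝ} (hw : IsWeight w) {u v : E}
    (hlt : extract κ t w u < w u) (huv : κ u < κ v) : extract κ t w v = 0 := by
  have h1 : t < massBelow κ w (κ u) + w u := by
    by_contra! hle
    have := hw.nonneg u
    rw [extract_apply, min_eq_right hle, min_eq_right (by linarith)] at hlt
    linarith
  have h2 : massBelow κ w (κ u) + w u ≤ massBelow κ w (κ v) := by
    rw [massBelow_eq_sum κ w (κ v)]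
    exact massBelow_add_le hw fun x hx hxu => Finset.mem_filter.2 ⟨hx, hxu.trans_lt huv⟩
  have := hw.nonneg v
  rw [extract_apply, min_eq_left (by linarith), min_eq_left (by linarith), sub_self]

/-- The sum telescopes along the order; the induction removes the last vertex, whose predecessors
are all the others. -/
theorem sum_min_sub_min (κ : E → α) (w : E → ℝ) (t : ℝ) (s : Finset E)
    (hinj : InjOn κ (s : Set E)) :
    ∑ u ∈ s, (min t (∑ v ∈ s.filter (fun v => κ v < κ u), w v + w u) -
      min t (∑ v ∈ s.filter (fun v => κ v < κ u), w v)) = min t (∑ u ∈ s, w u) - min t 0 := by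
  induction s using Finset.induction_on_max_value κ with
  | empty => simp
  | insert a s has hmax ih =>
    have hlt : ∀ x ∈ s, κ x < κ a := fun x hx => lt_of_le_of_ne (hmax x hx) fun h =>
      has (hinj (by simp [hx]) (by simp) h ▸ hx)
    have h1 : (insert a s).filter (fun v => κ v < κ a) = s := by
      rw [Finset.filter_insert, if_neg (lt_irrefl _), Finset.filter_true_of_mem hlt]
    rw [Finset.sum_insert has, h1, Finset.sum_insert has]
    have h2 : ∀ u ∈ s, (insert a s).filter (fun v => κ v < κ u) =
        s.filter (fun v => κ v < κ u) := fun u hu => by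
      rw [Finset.filter_insert, if_neg (hlt u hu).not_gt]
    have h3 := ih (hinj.mono (by simp))
    rw [Finset.sum_congr rfl fun u hu => by rw [← h2 u hu]] at h3
    rw [h3, add_comm (w a)]
    ring

theorem lc_one_extract {κ : E → α} {t : ℝ} (ht0 : 0 ≤ t) (ht1 : t ≤ 1) {w : E →₀ ℝ}
    (hw : IsWeight w) (hinj : InjOn κ (w.support : Set E)) :
    lc (fun _ => (1 : ℝ)) (extract κ t w) = t := by
  rw [lc_eq_sum (support_extract κ t w)]
  simp only [extract_apply, massBelow_eq_sum, smul_eq_mul, mul_one]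
  rw [sum_min_sub_min κ w t _ hinj, hw.sum_eq_one, min_eq_left ht1, min_eq_right ht0, sub_zero]

/-- What remains of `w` after the extraction of its first `t` units of mass, normalized. -/
noncomputable def remainder (κ : E → α) (t : ℝ) (w : E →₀ ℝ) : E →₀ ℝ :=
  (1 - t)⁻¹ • (w - extract κ t w)

theorem isWeight_remainder {κ : E → α} {t : ℝ} (ht0 : 0 ≤ t) (ht1 : t < 1) {w : E →₀ ℝ}
    (hw : IsWeight w) (hinj : InjOn κ (w.support : Set E)) : IsWeight (remainder κ t w) := by
  have h1 : 0 < 1 - t := by linarith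
  constructor
  · intro v
    simp only [remainder, Finsupp.smul_apply, Finsupp.sub_apply, smul_eq_mul]
    exact mul_nonneg (inv_nonneg.2 h1.le) (sub_nonneg.2 (extract_le hw v))
  · rw [remainder, map_smul, map_sub, lc_one_extract ht0 ht1.le hw hinj, hw.mass, smul_eq_mul,
      inv_mul_cancel₀ h1.ne']

theorem support_remainder (κ : E → α) (t : ℝ) (w : E →₀ ℝ) :
    (remainder κ t w).support ⊆ w.support :=
  Finsupp.support_smul.trans (Finsupp.support_sub.trans
    (Finset.union_subset subset_rfl (support_extract κ t w)))

theorem extract_add_remainder (κ : E → α) {t : ℝ} (ht1 : t < 1) (w : E →₀ ℝ) :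
    extract κ t w + (1 - t) • remainder κ t w = w := by
  rw [remainder, smul_smul, mul_inv_cancel₀ (by linarith), one_smul]
  abel

/-- Extraction depends only on masses and order, and both can be read off in the image. Hence two
weight systems with the same push-forward are extracted equally at common vertices. -/
theorem extract_mapDomain {F : Type*} {f : E → F} {κ : F → α} {t : ℝ} {w : E →₀ ℝ}
    (hinj : InjOn f (w.support : Set E)) {u : E} (hu : u ∈ w.support) :
    w.mapDomain f (f u) = w u ∧
      extract κ t (w.mapDomain f) (f u) = extract (fun v => κ (f v)) t w u := by
  have h1 : w.mapDomain f (f u) = w u := Finsupp.mapDomain_apply' _ _ subset_rfl hinj hu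
  refine ⟨h1, ?_⟩
  have h2 : ∀ c, massBelow κ (w.mapDomain f) c = massBelow (fun v => κ (f v)) w c := fun c => by
    rw [massBelow, lc_mapDomain]
    rfl
  rw [extract_apply, extract_apply, h1, h2]

end Extraction

/-! ### The straightening homotopy and its injectivity on fibres -/

section Homotopy

variable {E F W : Type*} [AddCommGroup E] [Module ℝ E] [AddCommGroup F] [Module ℝ F]
  [AddCommGroup W] [Module ℝ W]

/-- The barycentric weights of a point of a complex. -/
noncomputable def weights (K : Finset (Finset E)) (x : E) : E →₀ ℝ :=
  if h : x ∈ space K then h.choose else 0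

theorem isWeight_weights {K : Finset (Finset E)} {x : E} (hx : x ∈ space K) :
    IsWeight (weights K x) ∧ (weights K x).support ∈ K ∧ lc id (weights K x) = x := by
  rw [weights, dif_pos hx]
  exact hx.choose_spec

theorem weights_lc {K : Finset (Finset E)} (hK : IsComplex K) {w : E →₀ ℝ} (hw : IsWeight w)
    (hs : w.support ∈ K) : weights K (lc id w) = w := by
  obtain ⟨h1, h2, h3⟩ := isWeight_weights (K := K) ⟨w, hw, hs, rfl⟩
  exact hK.uniq _ _ h1 hw h2 hs h3

/-- The straightening of `g`: the first `t` units of mass are mapped linearly, the rest by `g`. -/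
noncomputable def straighten (K : Finset (Finset E)) (f : E → F) (g : E → W) (o : F → ℕ ×ₗ ℕ)
    (t : ℝ) (x : E) : W :=
  lc g (extract (fun u => o (f u)) t (weights K x)) +
    (1 - t) • g ((1 - t)⁻¹ • (x - lc id (extract (fun u => o (f u)) t (weights K x))))

variable {K : Finset (Finset E)} {f : E → F} {g : E → W} {o : F → ℕ ×ₗ ℕ}

omit [AddCommGroup F] [Module ℝ F] in
theorem straighten_zero {x : E} (hx : x ∈ space K) : straighten K f g o 0 x = g x := by
  rw [straighten, extract_zero (isWeight_weights hx).1]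
  simp

omit [AddCommGroup F] [Module ℝ F] in
theorem straighten_one {x : E} (hx : x ∈ space K) :
    straighten K f g o 1 x = lc g (weights K x) := by
  rw [straighten, extract_one (isWeight_weights hx).1]
  simp

omit [AddCommGroup F] [Module ℝ F] in
theorem linearOn_straighten_one (hK : IsComplex K) : LinearOn K (straighten K f g o 1) := by
  intro w hw hs
  rw [straighten_one ⟨w, hw, hs, rfl⟩, weights_lc hK hw hs]
  refine lc_congr fun v hv => ?_
  have hv1 : IsWeight (Finsupp.single v (1 : ℝ)) := isWeight_single v
  have hvs : (Finsupp.single v (1 : ℝ)).support ∈ K := hK.down _ hs _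
    (Finsupp.support_single_subset.trans (by simpa using hv))
  have hvx : lc id (Finsupp.single v (1 : ℝ)) = v := by simp
  have := straighten_one (f := f) (g := g) (o := o) (K := K) ⟨_, hv1, hvs, hvx⟩
  rw [this]
  nth_rw 2 [← hvx]
  rw [weights_lc hK hv1 hvs]
  simp

omit [AddCommGroup F] [Module ℝ F] in
theorem lc_id_remainder {x : E} (hx : x ∈ space K) (t : ℝ) :
    (1 - t)⁻¹ • (x - lc id (extract (fun u => o (f u)) t (weights K x))) =
      lc id (remainder (fun u => o (f u)) t (weights K x)) := by
  rw [remainder, map_smul, map_sub, (isWeight_weights hx).2.2]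

/-- The straightening fixes the points of the faces on which `g` is affine. -/
theorem straighten_eq (hK : IsOrderedLift K f g o) {x : E} (hx : x ∈ space K) {A : E →ᵃ[ℝ] W}
    (hA : ∀ y ∈ convexHull ℝ ((weights K x).support : Set E), g y = A y) {t : ℝ} (ht0 : 0 ≤ t)
    (ht1 : t ≤ 1) : straighten K f g o t x = g x := by
  obtain ⟨hw, hs, hwx⟩ := isWeight_weights hx
  have hx' : x ∈ convexHull ℝ ((weights K x).support : Set E) :=
    mem_convexHull_iff_weight.2 ⟨_, hw, subset_rfl, hwx⟩
  have hgA : ∀ v ∈ (weights K x).support, g v = A v := fun v hv =>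
    hA v (subset_convexHull ℝ _ hv)
  have hgx : g x = lc A (weights K x) := by
    rw [hA x hx', ← affineMap_lc A hw.mass, hwx]
  rcases ht1.eq_or_lt with rfl | ht1
  · rw [straighten_one hx, hgx]
    exact lc_congr hgA
  · have hinj := hK.ordInj _ hs
    have hρ := isWeight_remainder ht0 ht1 hw hinj
    have hρs := support_remainder (fun u => o (f u)) t (weights K x)
    rw [straighten, lc_id_remainder hx, hA _ (mem_convexHull_iff_weight.2 ⟨_, hρ, hρs, rfl⟩),
      affineMap_lc A hρ.mass, lc_congr (fun v hv => hgA v (support_extract _ _ _ hv)), hgx,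
      ← map_smul, ← map_add, extract_add_remainder _ ht1]

omit [AddCommGroup E] [Module ℝ E] in
theorem smul_add_mem_convexHull {s : Finset E} {C : Set W} {a : E → ℝ} {b c : ℝ}
    (ha : ∀ u ∈ s, 0 ≤ a u) (hb : 0 ≤ b) (hc : 0 < c) (hsum : ∑ u ∈ s, a u + b = c)
    (hg : ∀ u ∈ s, g u ∈ C) {y : W} (hy : y ∈ C) :
    c⁻¹ • (∑ u ∈ s, a u • g u + b • y) ∈ convexHull ℝ C := by
  have h := (convex_convexHull ℝ C).sum_mem (t := Finset.insertNone s)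
    (w := fun i => i.elim (c⁻¹ * b) (fun u => c⁻¹ * a u)) (z := fun i => i.elim y g)
    (by
      intro i hi
      cases i with
      | none => exact mul_nonneg (inv_nonneg.2 hc.le) hb
      | some u =>
        exact mul_nonneg (inv_nonneg.2 hc.le) (ha u (Finset.some_mem_insertNone.1 hi)))
    (by
      rw [Finset.sum_insertNone]
      simp only [Option.elim]
      rw [← Finset.mul_sum, ← mul_add, add_comm, hsum, inv_mul_cancel₀ hc.ne'])
    (by
      intro i hi
      cases i with
      | none => exact subset_convexHull ℝ _ hy
      | some u => exact subset_convexHull ℝ _ (hg u (Finset.some_mem_insertNone.1 hi)))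
  rw [Finset.sum_insertNone] at h
  simp only [Option.elim, mul_smul] at h
  rwa [← Finset.smul_sum, ← smul_add, add_comm] at h

/-- If the part of `w` on `s ∩ s'` is extracted, then the rest contributes a positive multiple of
a point in the convex hull of the image of the face spanned by `s \ s'`. -/
theorem exists_mem_convexHull_of_extracted (hK : IsOrderedLift K f g o) {x : E}
    (hx : x ∈ space K) {t : ℝ} (ht0 : 0 ≤ t) (ht1 : t ≤ 1) {s₀ : Finset E}
    (hs₀ : s₀ ⊆ (weights K x).support)
    (hext : ∀ u ∈ s₀, extract (fun u => o (f u)) t (weights K x) u = weights K x u)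
    (hne : ((weights K x).support \ s₀).Nonempty) :
    0 < 1 - ∑ u ∈ s₀, weights K x u ∧
      (1 - ∑ u ∈ s₀, weights K x u)⁻¹ •
        (straighten K f g o t x - ∑ u ∈ s₀, weights K x u • g u) ∈
      convexHull ℝ (g '' convexHull ℝ (((weights K x).support \ s₀ : Finset E) : Set E)) := by
  obtain ⟨hw, hs, hwx⟩ := isWeight_weights hx
  set w := weights K x with hwdef
  set s₁ := w.support \ s₀ with hs₁
  set κ := fun u => o (f u) with hκ
  have hinj := hK.ordInj _ hs
  have hpos : 0 < ∑ u ∈ s₁, w u := Finset.sum_pos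
    (fun u hu => hw.pos (Finset.sdiff_subset hu)) hne
  have hmass := hw.mass
  rw [lc_eq_sum subset_rfl, ← Finset.sum_sdiff hs₀] at hmass
  simp only [smul_eq_mul, mul_one] at hmass
  have hc : 1 - ∑ u ∈ s₀, w u = ∑ u ∈ s₁, w u := by linarith
  refine ⟨hc ▸ hpos, ?_⟩
  have hemass := lc_one_extract ht0 ht1 hw hinj
  rw [lc_eq_sum (support_extract _ _ _), ← Finset.sum_sdiff hs₀] at hemass
  simp only [smul_eq_mul, mul_one] at hemass
  rw [Finset.sum_congr rfl hext] at hemass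
  have hgs : ∀ u ∈ s₁, g u ∈ g '' convexHull ℝ (s₁ : Set E) := fun u hu =>
    mem_image_of_mem g (subset_convexHull ℝ _ hu)
  obtain ⟨u₀, hu₀⟩ := hne
  -- The remainder has no mass on `s₀`, so it lies in the simplex of `s₁`. For `t = 1` its
  -- coefficient vanishes and any point of the image serves.
  have hy : ∃ y ∈ g '' convexHull ℝ (s₁ : Set E), (1 - t) • g ((1 - t)⁻¹ •
      (x - lc id (extract κ t w))) = (1 - t) • y := by
    rcases ht1.eq_or_lt with rfl | ht1
    · exact ⟨g u₀, hgs u₀ hu₀, by simp⟩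
    · refine ⟨_, mem_image_of_mem g ?_, rfl⟩
      rw [lc_id_remainder hx]
      refine mem_convexHull_iff_weight.2 ⟨_, isWeight_remainder ht0 ht1 hw hinj, ?_, rfl⟩
      intro v hv
      refine Finset.mem_sdiff.2 ⟨support_remainder _ _ _ hv, fun hv0 => ?_⟩
      rw [Finsupp.mem_support_iff] at hv
      simp [remainder, ← hκ, hext v hv0] at hv
  obtain ⟨y, hyC, hyeq⟩ := hy
  have hsum : ∑ u ∈ s₀, extract κ t w u • g u = ∑ u ∈ s₀, w u • g u :=
    Finset.sum_congr rfl fun u hu => by rw [hext u hu]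
  have heq : straighten K f g o t x - ∑ u ∈ s₀, w u • g u =
      ∑ u ∈ s₁, extract κ t w u • g u + (1 - t) • y := by
    rw [straighten, ← hwdef, ← hκ, hyeq, lc_eq_sum (support_extract _ _ _),
      ← Finset.sum_sdiff hs₀, hsum]
    abel
  rw [heq]
  exact smul_add_mem_convexHull (fun u _ => extract_nonneg hw u) (by linarith) (hc ▸ hpos)
    (by linarith) hgs hyC

theorem straighten_injective (hK : IsOrderedLift K f g o)
    (hfib : ∀ x ∈ space K, ∀ y ∈ space K, f x = f y → g x = g y → x = y) {t : ℝ} (ht0 : 0 ≤ t)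
    (ht1 : t ≤ 1) {x x' : E} (hx : x ∈ space K) (hx' : x' ∈ space K) (hxx : f x = f x')
    (heq : straighten K f g o t x = straighten K f g o t x') : x = x' := by
  obtain ⟨hw, hs, hwx⟩ := isWeight_weights hx
  obtain ⟨hw', hs', hwx'⟩ := isWeight_weights hx'
  have hlin := hK.linear _ hw hs
  have hlin' := hK.linear _ hw' hs'
  have hm := hK.push _ _ hw hw' hs hs' (by rw [← hlin, ← hlin', hwx, hwx', hxx])
  set w := weights K x with hwdef
  set w' := weights K x' with hwdef'
  set κ := fun u => o (f u) with hκ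
  have hκs := hK.ordInj _ hs
  have hκs' := hK.ordInj _ hs'
  have hfs : InjOn f (w.support : Set E) := fun u hu v hv h => hκs hu hv (congrArg o h)
  have hfs' : InjOn f (w'.support : Set E) := fun u hu v hv h => hκs' hu hv (congrArg o h)
  have himg : w.support.image f = w'.support.image f := by
    rw [← hw.support_mapDomain, ← hw'.support_mapDomain, hm]
  have hcom : ∀ u ∈ w.support, u ∈ w'.support → w u = w' u ∧ extract κ t w u = extract κ t w' u := by
    intro u hu hu'
    have h1 := extract_mapDomain (κ := o) (t := t) hfs hu
    have h2 := extract_mapDomain (κ := o) (t := t) hfs' hu'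
    rw [hm] at h1
    exact ⟨h1.1.symm.trans h2.1, h1.2.symm.trans h2.2⟩
  -- Suppose some common vertex is not exhausted. By `initial` the vertices that are not common come
  -- later, so nothing is extracted from them. The extractions therefore coincide, `g` agrees at the
  -- remainders, and these lie in one fibre of `f`.
  by_cases hA : ∃ u ∈ w.support, u ∈ w'.support ∧ extract κ t w u < w u
  · obtain ⟨u, hu, hu', hlt⟩ := hA
    have ht1' : t < 1 := by
      refine lt_of_le_of_ne ht1 ?_
      rintro rfl
      rw [extract_one hw] at hlt
      exact lt_irrefl _ hlt
    have hlt' : extract κ t w' u < w' u := by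
      rw [← (hcom u hu hu').1, ← (hcom u hu hu').2]; exact hlt
    have hee : extract κ t w = extract κ t w' := by
      ext v
      by_cases hv : v ∈ w.support
      · by_cases hv' : v ∈ w'.support
        · exact (hcom v hv hv').2
        · rw [extract_eq_zero_of_lt hw hlt (hK.initial _ hs _ hs' himg u hu hu' v hv hv'),
            Finsupp.notMem_support_iff.1 fun h => hv' (support_extract _ _ _ h)]
      · by_cases hv' : v ∈ w'.support
        · rw [extract_eq_zero_of_lt hw' hlt'
            (hK.initial _ hs' _ hs himg.symm u hu' hu v hv' hv),
            Finsupp.notMem_support_iff.1 fun h => hv (support_extract _ _ _ h)]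
        · rw [Finsupp.notMem_support_iff.1 fun h => hv' (support_extract _ _ _ h),
            Finsupp.notMem_support_iff.1 fun h => hv (support_extract _ _ _ h)]
    have h1t : (1 - t) ≠ 0 := by linarith
    rw [straighten, straighten, ← hwdef, ← hwdef', ← hκ, hee] at heq
    have hgz := smul_right_injective W h1t (add_left_cancel heq)
    have hρ := isWeight_remainder ht0 ht1' hw hκs
    have hρ' := isWeight_remainder ht0 ht1' hw' hκs'
    have hρs := hK.complex.down _ hs _ (support_remainder κ t w)
    have hρs' := hK.complex.down _ hs' _ (support_remainder κ t w')
    have hz : (1 - t)⁻¹ • (x - lc id (extract κ t w')) = lc id (remainder κ t w) := by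
      rw [← hee]; exact lc_id_remainder hx t
    have hz' : (1 - t)⁻¹ • (x' - lc id (extract κ t w')) = lc id (remainder κ t w') :=
      lc_id_remainder hx' t
    have hzz := hfib _ ⟨_, hρ, hρs, hz.symm⟩ _ ⟨_, hρ', hρs', hz'.symm⟩ (by
      rw [hz, hz', hK.linear _ hρ hρs, hK.linear _ hρ' hρs', remainder, remainder, map_smul,
        map_smul, map_sub, map_sub, hee, ← hlin, ← hlin', hwx, hwx', hxx]) hgz
    exact sub_left_injective (smul_right_injective E (inv_ne_zero h1t) hzz)
  -- Now all common vertices are exhausted and contribute equally. After subtraction and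
  -- normalization one point would lie in the hulls of the `g`-images of both complementary faces,
  -- which are disjoint lifts of one simplex.
  · push Not at hA
    have hext : ∀ u ∈ w.support ∩ w'.support, extract κ t w u = w u := fun u hu =>
      le_antisymm (extract_le hw u)
        (hA u (Finset.mem_inter.1 hu).1 (Finset.mem_inter.1 hu).2)
    have hext' : ∀ u ∈ w.support ∩ w'.support, extract κ t w' u = w' u := fun u hu => by
      obtain ⟨h1, h2⟩ := Finset.mem_inter.1 hu
      rw [← (hcom u h1 h2).1, ← (hcom u h1 h2).2, hext u hu]
    have hcorr : ∀ {v v' : E →₀ ℝ}, v.support.image f = v'.support.image f →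
        InjOn f (v.support : Set E) →
        ∀ u ∈ v.support \ (v.support ∩ v'.support),
          f u ∈ (v'.support \ (v.support ∩ v'.support)).image f := by
      intro v v' hvv hinj u hu
      obtain ⟨h1, h2⟩ := Finset.mem_sdiff.1 hu
      obtain ⟨u', hu', he⟩ := Finset.mem_image.1 (hvv ▸ Finset.mem_image_of_mem f h1)
      refine Finset.mem_image.2 ⟨u', Finset.mem_sdiff.2 ⟨hu', fun hc => ?_⟩, he⟩
      have h3 := hinj (Finset.mem_inter.1 hc).1 h1 he
      exact h2 (h3 ▸ hc)
    have himg₁ : (w.support \ (w.support ∩ w'.support)).image f =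
        (w'.support \ (w.support ∩ w'.support)).image f := by
      ext y
      constructor
      · intro hy
        obtain ⟨u, hu, rfl⟩ := Finset.mem_image.1 hy
        exact hcorr himg hfs u hu
      · intro hy
        obtain ⟨u, hu, rfl⟩ := Finset.mem_image.1 hy
        have := hcorr himg.symm hfs' u (by rwa [Finset.inter_comm])
        rwa [Finset.inter_comm] at this
    by_cases hne : (w.support \ (w.support ∩ w'.support)).Nonempty
    · have hne' : (w'.support \ (w.support ∩ w'.support)).Nonempty := by
        rw [← Finset.image_nonempty (f := f), ← himg₁]
        exact hne.image f
      obtain ⟨-, h1⟩ := exists_mem_convexHull_of_extracted hK hx ht0 ht1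
        Finset.inter_subset_left hext hne
      obtain ⟨-, h2⟩ := exists_mem_convexHull_of_extracted hK hx' ht0 ht1
        Finset.inter_subset_right hext' hne'
      have hww : ∀ u ∈ w.support ∩ w'.support, w' u = w u := fun u hu =>
        (hcom u (Finset.mem_inter.1 hu).1 (Finset.mem_inter.1 hu).2).1.symm
      have hsum : ∑ u ∈ w.support ∩ w'.support, w' u • g u =
          ∑ u ∈ w.support ∩ w'.support, w u • g u :=
        Finset.sum_congr rfl fun u hu => by rw [hww u hu]
      rw [← hwdef', Finset.sum_congr rfl hww, hsum, ← heq] at h2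
      rw [← hwdef] at h1
      refine absurd h2 (disjoint_left.1 (hK.disj _ (hK.complex.down _ hs _ Finset.sdiff_subset) _
        (hK.complex.down _ hs' _ Finset.sdiff_subset) himg₁ ?_) h1)
      rw [Finset.disjoint_left]
      intro u hu hu'
      exact (Finset.mem_sdiff.1 hu).2 (Finset.mem_inter.2
        ⟨(Finset.mem_sdiff.1 hu).1, (Finset.mem_sdiff.1 hu').1⟩)
    · have hne' : ¬ (w'.support \ (w.support ∩ w'.support)).Nonempty := by
        rw [← Finset.image_nonempty (f := f), ← himg₁, Finset.image_nonempty]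
        exact hne
      rw [Finset.not_nonempty_iff_eq_empty, Finset.sdiff_eq_empty_iff_subset] at hne hne'
      have hww : w = w' := by
        ext u
        by_cases hu : u ∈ w.support
        · exact (hcom u hu (Finset.mem_inter.1 (hne hu)).2).1
        · rw [Finsupp.notMem_support_iff.1 hu, Finsupp.notMem_support_iff.1 fun h =>
            hu (Finset.mem_inter.1 (hne' h)).1]
      rw [← hwx, ← hwx', hww]

end Homotopy

/-! ### Continuity of the straightening -/

section Continuity

variable {E F W : Type*} [NormedAddCommGroup E] [NormedSpace ℝ E] [FiniteDimensional ℝ E]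
  [AddCommGroup F] [Module ℝ F] [NormedAddCommGroup W] [NormedSpace ℝ W]

theorem AffineOnFaces.continuousOn {S : Finset (Finset E)} (hS : IsComplex S) {h : E → W}
    (hh : AffineOnFaces S h) : ContinuousOn h (space S) := by
  have hsp : space S = ⋃ s : S, convexHull ℝ ((s : Finset E) : Set E) := by
    ext x
    simp [hS.mem_space_iff]
  rw [hsp]
  refine (locallyFinite_of_finite _).continuousOn_iUnion (fun s => ?_) fun s => ?_
  · exact (s.1.finite_toSet.isCompact_convexHull (𝕜 := ℝ)).isClosed
  · obtain ⟨A, hA⟩ := hh s s.2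
    exact (AffineMap.continuous_of_finiteDimensional A).continuousOn.congr hA

omit [FiniteDimensional ℝ E] in
theorem IsComplex.isCompact_space {S : Finset (Finset E)} (hS : IsComplex S) :
    IsCompact (space S) := by
  have hsp : space S = ⋃ s ∈ S, convexHull ℝ ((s : Finset E) : Set E) := by
    ext x
    simp [hS.mem_space_iff]
  rw [hsp]
  exact S.isCompact_biUnion fun s _ => s.finite_toSet.isCompact_convexHull (𝕜 := ℝ)

theorem continuousOn_lc_weights {K : Finset (Finset E)} (hK : IsComplex K) (h : E → W) :
    ContinuousOn (fun x => lc h (weights K x)) (space K) := by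
  have hlin : LinearOn K (fun x => lc h (weights K x)) := by
    intro w hw hs
    simp only
    rw [weights_lc hK hw hs]
    refine lc_congr fun v hv => ?_
    have hvs : (Finsupp.single v (1 : ℝ)).support ∈ K := hK.down _ hs _
      (Finsupp.support_single_subset.trans (by simpa using hv))
    have := weights_lc hK (isWeight_single v) hvs
    simp only [lc, Finsupp.linearCombination_single, id, one_smul] at this ⊢
    rw [this]
    simp
  exact (hlin.affineOnFaces hK).continuousOn hK

theorem continuousOn_weights {K : Finset (Finset E)} (hK : IsComplex K) (v : E) :
    ContinuousOn (fun x => weights K x v) (space K) := by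
  refine (continuousOn_lc_weights hK (fun u => if u = v then (1 : ℝ) else 0)).congr fun x _ => ?_
  change weights K x v = lc _ (weights K x)
  rw [Finsupp.linearCombination_apply, Finsupp.sum]
  simp only [smul_eq_mul, mul_ite, mul_one, mul_zero, Finset.sum_ite_eq']
  split_ifs with h
  · rfl
  · exact Finsupp.notMem_support_iff.1 h

variable {K : Finset (Finset E)} {f : E → F} {o : F → ℕ ×ₗ ℕ}

omit [AddCommGroup F] [Module ℝ F] in
theorem continuousOn_lc_extract (hK : IsComplex K) (h : E → W) :
    ContinuousOn (fun p : ℝ × E => lc h (extract (fun u => o (f u)) p.1 (weights K p.2)))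
      (Icc 0 1 ×ˢ space K) := by
  have hsnd : MapsTo Prod.snd (Icc (0 : ℝ) 1 ×ˢ space K) (space K) := fun p hp => hp.2
  have hcoef : ∀ u, ContinuousOn
      (fun p : ℝ × E => extract (fun u => o (f u)) p.1 (weights K p.2) u)
      (Icc 0 1 ×ˢ space K) := by
    intro u
    have h1 : ContinuousOn (fun p : ℝ × E => weights K p.2 u) (Icc (0 : ℝ) 1 ×ˢ space K) :=
      (continuousOn_weights hK u).comp continuousOn_snd hsnd
    have h2 : ContinuousOn (fun p : ℝ × E => massBelow (fun u => o (f u)) (weights K p.2)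
        (o (f u))) (Icc (0 : ℝ) 1 ×ˢ space K) :=
      (continuousOn_lc_weights hK _).comp continuousOn_snd hsnd
    simp only [extract_apply]
    exact (continuous_min.comp_continuousOn (continuousOn_fst.prodMk (h2.add h1))).sub
      (continuous_min.comp_continuousOn (continuousOn_fst.prodMk h2))
  have hsum : ContinuousOn (fun p : ℝ × E => ∑ u ∈ K.biUnion id,
      extract (fun u => o (f u)) p.1 (weights K p.2) u • h u) (Icc 0 1 ×ˢ space K) :=
    continuousOn_finsetSum _ fun u _ => (hcoef u).smul continuousOn_const
  refine hsum.congr fun p hp => lc_eq_sum ?_ h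
  refine (support_extract _ _ _).trans fun u hu => ?_
  exact Finset.mem_biUnion.2 ⟨_, (isWeight_weights hp.2).2.1, hu⟩

/-- Only `t = 1` is delicate, since the normalization degenerates there. For `t < 1` the remainder
stays in the compact complex, where `g` is bounded, and the factor `1 - t` tends to zero. -/
theorem continuousOn_straighten {g : E → W} (hK : IsOrderedLift K f g o)
    (hg : ContinuousOn g (space K)) :
    ContinuousOn (fun p : ℝ × E => straighten K f g o p.1 p.2) (Icc 0 1 ×ˢ space K) := by
  have hmem : ∀ p ∈ Icc (0 : ℝ) 1 ×ˢ space K, p.1 ≠ 1 → (1 - p.1)⁻¹ •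
      (p.2 - lc id (extract (fun u => o (f u)) p.1 (weights K p.2))) ∈ space K := by
    intro p hp hp1
    obtain ⟨hw, hs, -⟩ := isWeight_weights hp.2
    rw [lc_id_remainder hp.2]
    exact ⟨_, isWeight_remainder hp.1.1 (lt_of_le_of_ne hp.1.2 hp1) hw (hK.ordInj _ hs),
      hK.complex.down _ hs _ (support_remainder _ _ _), rfl⟩
  refine (continuousOn_lc_extract hK.complex g).add ?_
  obtain ⟨B, hB⟩ := (hK.complex.isCompact_space.image_of_continuousOn hg).isBounded.exists_norm_le
  intro p hp
  by_cases hp1 : p.1 = 1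
  · rw [ContinuousWithinAt, hp1, sub_self, zero_smul]
    have hlim : Filter.Tendsto (fun q : ℝ × E => |1 - q.1| * B)
        (nhdsWithin p (Icc 0 1 ×ˢ space K)) (nhds 0) := by
      have : Continuous (fun q : ℝ × E => |1 - q.1| * B) := by fun_prop
      have h := this.tendsto p
      rw [hp1, sub_self, abs_zero, zero_mul] at h
      exact h.mono_left nhdsWithin_le_nhds
    refine squeeze_zero_norm' ?_ hlim
    filter_upwards [self_mem_nhdsWithin] with q hq
    rw [norm_smul, Real.norm_eq_abs]
    -- At `t = 1` the argument of `g` may lie outside the complex, but its coefficient is zero.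
    by_cases hq1 : q.1 = 1
    · simp [hq1]
    · exact mul_le_mul_of_nonneg_left (hB _ (mem_image_of_mem g (hmem q hq hq1))) (abs_nonneg _)
  · have hne : 1 - p.1 ≠ 0 := sub_ne_zero.2 (Ne.symm hp1)
    have h1 : ContinuousWithinAt (fun q : ℝ × E => 1 - q.1) (Icc 0 1 ×ˢ space K) p := by
      fun_prop
    have hz : ContinuousWithinAt (fun q : ℝ × E => (1 - q.1)⁻¹ •
        (q.2 - lc id (extract (fun u => o (f u)) q.1 (weights K q.2))))
        (Icc 0 1 ×ˢ space K) p :=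
      (h1.inv₀ hne).smul (continuousWithinAt_snd.sub (continuousOn_lc_extract hK.complex id p hp))
    refine h1.smul ?_
    have hev : ∀ᶠ q in nhdsWithin p (Icc 0 1 ×ˢ space K), (1 - q.1)⁻¹ •
        (q.2 - lc id (extract (fun u => o (f u)) q.1 (weights K q.2))) ∈ space K := by
      have hopen : {q : ℝ × E | q.1 ≠ 1} ∈ nhds p :=
        (isOpen_ne_fun continuous_fst continuous_const).mem_nhds hp1
      filter_upwards [self_mem_nhdsWithin, mem_nhdsWithin_of_mem_nhds hopen] with q hq hq1
      exact hmem q hq hq1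
    exact Filter.Tendsto.comp (hg _ (hmem p hp hp1)) (tendsto_nhdsWithin_iff.2 ⟨hz, hev⟩)

end Continuity

/-! ### PL maps and PL embeddings through complexes -/

section PLMaps

variable {E V : Type*} [NormedAddCommGroup E] [NormedSpace ℝ E]
  [NormedAddCommGroup V] [NormedSpace ℝ V]

/-- The extension by zero of a map defined on a set. -/
noncomputable def extendZero {X V : Type*} [Zero V] {P : Set X} (h : P → V) (x : X) : V :=
  if hx : x ∈ P then h ⟨x, hx⟩ else 0

theorem extendZero_of_mem {X V : Type*} [Zero V] {P : Set X} (h : P → V) {x : X} (hx : x ∈ P) :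
    extendZero h x = h ⟨x, hx⟩ := dif_pos hx

theorem extendZero_coe {X V : Type*} [Zero V] {P : Set X} (h : P → V) (x : P) :
    extendZero h (x : X) = h x := extendZero_of_mem h x.2

omit [NormedSpace ℝ E] [NormedSpace ℝ V] in
theorem continuousOn_extendZero {P : Set E} {h : P → V} (hh : Continuous h) :
    ContinuousOn (extendZero h) P := by
  rw [continuousOn_iff_continuous_domRestrict]
  convert hh using 1
  funext x
  exact extendZero_coe h x

theorem exists_affineOnFaces {P : Set E} {h : P → V} (hh : IsPL h) :
    ∃ S : Finset (Finset E), IsComplex S ∧ space S = P ∧ AffineOnFaces S (extendZero h) := by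
  obtain ⟨K, ⟨hfin, hsp⟩, hA⟩ := hh
  obtain ⟨S, hS, hmem, hSsp⟩ := exists_isComplex K hfin
  refine ⟨S, hS, hSsp.trans hsp, fun s hs => ?_⟩
  rcases (hmem s).1 hs with rfl | hs'
  · exact ⟨0, by simp⟩
  · obtain ⟨A, hA⟩ := hA s hs'
    refine ⟨A, fun x hx => ?_⟩
    have hxP : x ∈ P := hsp ▸ K.convexHull_subset_space hs' hx
    rw [extendZero_of_mem h hxP, hA ⟨x, hxP⟩ hx]

theorem isPL_of_linearOn {P : Set E} {h : P → V} {S : Finset (Finset E)} (hS : IsComplex S)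
    (hsp : space S = P) {h' : E → V} (hlin : LinearOn S h') (hh : ∀ x : P, h x = h' x) :
    IsPL h := by
  subst hsp
  refine ⟨_, hS.isTriangulation, fun s hs => ?_⟩
  obtain ⟨A, hA⟩ := hlin.affineOnFaces hS s hs.1
  exact ⟨A, fun x hx => (hh x).trans (hA _ hx)⟩

/-- By `IsComplex.image` the images of the faces form a complex, and the inverse map is again linear
on it. -/
theorem isPLEmbedding_of_linearOn {P : Set E} {h : P → V} {S : Finset (Finset E)}
    (hS : IsComplex S) (hsp : space S = P) {h' : E → V} (hlin : LinearOn S h')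
    (hh : ∀ x : P, h x = h' x) (hinj : InjOn h' P) : IsPLEmbedding h := by
  refine ⟨isPL_of_linearOn hS hsp hlin hh, ?_⟩
  have hinj' : Function.Injective h := fun x y hxy =>
    Subtype.ext (hinj x.2 y.2 (by rw [← hh, ← hh, hxy]))
  obtain ⟨hC, hCsp, hCr⟩ := hS.image hlin (hsp.symm ▸ hinj)
  have hrange : space (S.image (Finset.image h')) = range h := by
    rw [hCsp, hsp]
    ext y
    constructor
    · rintro ⟨x, hx, rfl⟩
      exact ⟨⟨x, hx⟩, hh _⟩
    · rintro ⟨x, rfl⟩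
      exact ⟨x, x.2, (hh x).symm⟩
  have hr := hCr (Function.invFunOn h' P) (by
    rw [hsp]; exact fun x hx => hinj.leftInvOn_invFunOn hx)
  refine ⟨(Equiv.ofInjective h hinj').symm, isPL_of_linearOn hC hrange hr ?_, fun x => ?_⟩
  · rintro ⟨_, x, rfl⟩
    have h1 : (⟨h x, x, rfl⟩ : range h) = Equiv.ofInjective h hinj' x := rfl
    rw [h1, Equiv.symm_apply_apply]
    change (x : E) = Function.invFunOn h' P (h x)
    rw [hh]
    exact (hinj.leftInvOn_invFunOn x.2).symm
  · exact (Equiv.ofInjective h hinj').symm_apply_apply x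

variable [FiniteDimensional ℝ E]

theorem continuous_of_isPL {P : Set E} {h : P → V} (hh : IsPL h) : Continuous h := by
  obtain ⟨S, hS, rfl, hA⟩ := exists_affineOnFaces hh
  have := continuousOn_iff_continuous_domRestrict.1 (hA.continuousOn hS)
  convert this using 1
  funext x
  exact (extendZero_coe h x).symm

end PLMaps

/-! ### Isotopies through lifts -/

section Lifts

variable {E F : Type*} [NormedAddCommGroup E] [NormedSpace ℝ E] [FiniteDimensional ℝ E]
  [NormedAddCommGroup F] [NormedSpace ℝ F] [FiniteDimensional ℝ F]
  {N : Set E} {M : Set F} {k : ℕ}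

theorem exists_isComplex_of_isCompactPolyhedron {E : Type*} [NormedAddCommGroup E]
    [NormedSpace ℝ E] {P : Set E} (hP : IsCompactPolyhedron P) :
    ∃ S : Finset (Finset E), IsComplex S ∧ space S = P := by
  obtain ⟨K, hfin, hsp⟩ := hP
  obtain ⟨S, hS, -, hSsp⟩ := exists_isComplex K hfin
  exact ⟨S, hS, hSsp.trans hsp⟩

omit [FiniteDimensional ℝ E] [FiniteDimensional ℝ F] in
/-- A map without positive-dimensional fibres is injective on each simplex on which it is
affine. -/
theorem injOn_of_isNondegenerate {f : N → M} (hnd : IsNondegenerate f) {C : Set E}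
    (hC : Convex ℝ C) (hCN : C ⊆ N) {A : E →ᵃ[ℝ] F}
    (hA : ∀ x ∈ C, extendZero (fun x => (f x : F)) x = A x) :
    InjOn (extendZero (fun x => (f x : F))) C := by
  intro x hx x' hx' hxx
  by_contra hne
  -- An affine map with equal values at `x` and `x'` is constant on the segment between them, which
  -- is then a `1`-simplex in a fibre.
  refine hnd (f ⟨x, hCN hx⟩) (lt_of_lt_of_le (b := ((1 : ℕ) : WithBot ℕ∞)) (by norm_num)
    (le_sSup ⟨1, ⟨![x, x'], affineIndependent_of_ne ℝ hne, ?_⟩, rfl⟩))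
  have hr : range ![x, x'] = {x, x'} := by
    simp [Matrix.range_cons, Matrix.range_empty, Set.pair_comm]
  rw [hr, convexHull_pair]
  intro z hz
  have hzC := hC.segment_subset hx hx' hz
  refine ⟨⟨z, hCN hzC⟩, Subtype.ext ?_, rfl⟩
  rw [← extendZero_of_mem (fun x => (f x : F)) (hCN hzC),
    ← extendZero_of_mem (fun x => (f x : F)) (hCN hx), hA z hzC, hA x hx]
  have hAxx : A x = A x' := by rw [← hA x hx, ← hA x' hx', hxx]
  have hmem : A z ∈ A '' segment ℝ x x' := mem_image_of_mem A hz
  rw [image_segment, ← hAxx, segment_same] at hmem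
  exact hmem

theorem isCompact_of_isCompactPolyhedron {E : Type*} [NormedAddCommGroup E]
    [NormedSpace ℝ E] {P : Set E} (hP : IsCompactPolyhedron P) : IsCompact P := by
  obtain ⟨S, hS, rfl⟩ := exists_isComplex_of_isCompactPolyhedron hP
  exact hS.isCompact_space

omit [FiniteDimensional ℝ F] in
theorem isEmbedding_of_isPLEmbedding (hN : IsCompactPolyhedron N) {f : N → M}
    {g : N → EuclideanSpace ℝ (Fin k)} (h : IsPLEmbedding (fun x => prodIncl (f x, g x))) :
    Topology.IsEmbedding (fun x => (f x, g x)) := by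
  have := isCompact_iff_compactSpace.1 (isCompact_of_isCompactPolyhedron hN)
  obtain ⟨hPL, r, -, hr⟩ := h
  have hc := continuous_of_isPL hPL
  have hcf : Continuous f := Topology.IsInducing.subtypeVal.continuous_iff.2
    (continuous_fst.comp hc)
  have hcg : Continuous g := continuous_snd.comp hc
  refine ((hcf.prodMk hcg).isClosedEmbedding fun x y hxy => hr.injective ?_).isEmbedding
  refine Subtype.ext ?_
  have h1 : f x = f y := congrArg Prod.fst hxy
  have h2 : g x = g y := congrArg Prod.snd hxy
  change prodIncl (f x, g x) = prodIncl (f y, g y)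
  rw [h1, h2]

/-- A lift which is an embedding and PL on `N₀` is isotopic to a PL embedding, through lifts and
relative to `N₀`. -/
theorem exists_isotopic_isPLEmbedding (hM : IsCompactPolyhedron M) {f : N → M}
    (hf : IsPL (fun x => (f x : F))) (hnd : IsNondegenerate f)
    {e : N → M × EuclideanSpace ℝ (Fin k)} (he : Topology.IsEmbedding e) (hlift : IsLift f e)
    {N₀ : Set E} (hsub : N₀ ⊆ N)
    (hPL : IsPL (fun x : N₀ => prodIncl (e (Set.inclusion hsub x)))) :
    ∃ e' : N → M × EuclideanSpace ℝ (Fin k),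
      IsPLEmbedding (fun x => prodIncl (e' x)) ∧ IsotopicThroughLiftsRel f N₀ e e' := by
  obtain ⟨S₁, hS₁, hsp₁, hfA⟩ := exists_affineOnFaces hf
  obtain ⟨S₂, hS₂, hsp₂, heA⟩ := exists_affineOnFaces hPL
  obtain ⟨L, hL, hspL⟩ := exists_isComplex_of_isCompactPolyhedron hM
  set f' : E → F := extendZero (fun x => (f x : F)) with hf'
  set g' : E → EuclideanSpace ℝ (Fin k) := extendZero (fun x => (e x).2) with hg'
  have hface : ∀ s ∈ S₂, ∃ Λ : Finset (E →ᵃ[ℝ] ℝ),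
      convexHull ℝ (s : Set E) = {x | ∀ ℓ ∈ Λ, ℓ x ≤ 0} := fun s hs =>
    exists_halfspaces (hS₂.affineIndependent hs)
  choose! Λ hΛ using hface
  have hcutout : IsCutOut S₂ (fun s => convexHull ℝ (s : Set E)) Λ := hΛ
  -- The functionals defining the simplices of `N₀` no longer change sign on faces. The final
  -- triangulation inherits this, and the relative clause rests on it.
  obtain ⟨K₀, hK₀, hr₀, hcut₀⟩ := exists_isCut Λ S₂ hS₁
  have hsp₀ : space K₀ = N := hr₀.space_eq.trans hsp₁
  have hfA₀ : AffineOnFaces K₀ f' := fun s hs => by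
    obtain ⟨t, ht, hst⟩ := hr₀.exists_face' hs
    obtain ⟨A, hA⟩ := hfA t ht
    exact ⟨A, fun x hx => hA x (hst hx)⟩
  have hconvN : ∀ δ ∈ K₀, convexHull ℝ (δ : Set E) ⊆ N := fun δ hδ x hx =>
    hsp₀ ▸ hK₀.mem_space_iff.2 ⟨δ, hδ, hx⟩
  have hinj : ∀ δ ∈ K₀, InjOn f' (convexHull ℝ (δ : Set E)) := fun δ hδ => by
    obtain ⟨A, hA⟩ := hfA₀ δ hδ
    exact injOn_of_isNondegenerate hnd (convex_convexHull ℝ _) (hconvN δ hδ) hA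
  have hmaps : MapsTo f' (space K₀) (space L) := by
    rw [hsp₀, hspL]
    intro x hx
    rw [hf', extendZero_of_mem _ hx]
    exact (f ⟨x, hx⟩).2
  have hfib : ∀ x ∈ N, ∀ y ∈ N, f' x = f' y → g' x = g' y → x = y := by
    intro x hx y hy hfxy hgxy
    rw [hf', extendZero_of_mem _ hx, extendZero_of_mem _ hy] at hfxy
    rw [hg', extendZero_of_mem _ hx, extendZero_of_mem _ hy] at hgxy
    have := he.injective (a₁ := ⟨x, hx⟩) (a₂ := ⟨y, hy⟩)
      (Prod.ext (by rw [hlift, hlift]; exact Subtype.ext hfxy) hgxy)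
    exact congrArg Subtype.val this
  have hgc : ContinuousOn g' N := continuousOn_extendZero (continuous_snd.comp he.continuous)
  obtain ⟨K, o, hK, hspK, hKK₀⟩ := exists_isOrderedLift hK₀ hL hfA₀ hinj hmaps
    (hsp₀.symm ▸ hgc) (hsp₀.symm ▸ hfib)
  have hspN : space K = N := hspK.trans hsp₀
  have hcutK : IsCut S₂ Λ K := fun i hi ℓ hℓ s hs => by
    obtain ⟨δ, hδ, hsδ⟩ := hKK₀ s hs
    exact (hcut₀ i hi ℓ hℓ δ hδ).mono hsδ
  have hfc : Continuous f := by
    have h1 : Continuous (fun x => (e x).1) := continuous_fst.comp he.continuous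
    exact h1.congr fun x => hlift x
  obtain ⟨H, hH⟩ : ∃ H, H = straighten K f' g' o := ⟨_, rfl⟩
  have hfibK : ∀ x ∈ space K, ∀ y ∈ space K, f' x = f' y → g' x = g' y → x = y :=
    hspN.symm ▸ hfib
  have hHinj : ∀ t : unitInterval, ∀ x y : N, f x = f y → H t x = H t y → x = y := by
    intro t x y hxy hHxy
    rw [hH] at hHxy
    refine Subtype.ext (straighten_injective hK hfibK t.2.1 t.2.2 (hspN.symm ▸ x.2)
      (hspN.symm ▸ y.2) ?_ hHxy)
    rw [hf', extendZero_coe, extendZero_coe, hxy]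
  have hHc : Continuous (fun p : unitInterval × N => H p.1 p.2) := by
    rw [hH]
    refine (continuousOn_straighten hK (hspN.symm ▸ hgc)).comp_continuous
      (f := fun p : unitInterval × N => ((p.1 : ℝ), (p.2 : E))) (by fun_prop) fun p => ?_
    exact ⟨p.1.2, hspN.symm ▸ p.2.2⟩
  have hcN : CompactSpace N := by
    rw [← isCompact_iff_compactSpace, ← hspN]
    exact hK.complex.isCompact_space
  refine ⟨fun x => (f x, H 1 x), ?_, fun p => (f p.2, H p.1 p.2),
    (hfc.comp continuous_snd).prodMk hHc, ?_, ?_, ?_, ?_⟩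
  · refine isPLEmbedding_of_linearOn hK.complex hspN (h' := fun x => (f' x, H 1 x)) ?_ ?_ ?_
    · intro w hw hs
      have h1 := hK.linear w hw hs
      have h2 := linearOn_straighten_one (f := f') (g := g') (o := o) hK.complex w hw hs
      rw [← hH] at h2
      have h3 : lc (fun x => (f' x, H 1 x)) w = (lc f' w, lc (H 1) w) := by
        rw [lc_eq_sum subset_rfl, lc_eq_sum subset_rfl, lc_eq_sum subset_rfl]
        ext1
        · rw [Prod.fst_sum]; rfl
        · rw [Prod.snd_sum]; rfl
      rw [h3]
      exact Prod.ext h1 h2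
    · intro x
      change (((f x : F)), H 1 x) = (f' x, H 1 x)
      rw [hf', extendZero_coe]
    · intro x hx y hy hxy
      have h1 := congrArg Prod.fst hxy
      have h2 := congrArg Prod.snd hxy
      rw [hH] at h2
      exact straighten_injective hK hfibK zero_le_one le_rfl (hspN.symm ▸ hx)
        (hspN.symm ▸ hy) h1 h2
  · intro x
    refine Prod.ext (hlift x).symm ?_
    change H 0 x = (e x).2
    rw [hH, ← extendZero_coe (fun x => (e x).2) x]
    exact straighten_zero (hspN.symm ▸ x.2)
  · exact fun x => rfl
  · intro t
    refine ⟨?_, fun x => rfl⟩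
    have hHt : Continuous (fun x : N => H t x) :=
      hHc.comp (f := fun x : N => (t, x)) (by fun_prop)
    have hc : Continuous (fun x : N => (f x, H t x)) := hfc.prodMk hHt
    exact (hc.isClosedEmbedding fun x y hxy =>
      hHinj t x y (congrArg Prod.fst hxy) (congrArg Prod.snd hxy)).isEmbedding
  · intro t x hx
    refine Prod.ext (hlift x).symm ?_
    change H t x = (e x).2
    rw [hH, ← extendZero_coe (fun x => (e x).2) x]
    have hxK : (x : E) ∈ space K := hspN.symm ▸ x.2
    obtain ⟨hw, hs, hwx⟩ := isWeight_weights hxK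
    obtain ⟨s₂, hs₂, hxs₂⟩ := hS₂.mem_space_iff.1 (hsp₂.symm ▸ hx)
    obtain ⟨A, hA⟩ := heA s₂ hs₂
    -- The face carrying `x` has all its vertices in the simplex of `s₂`, on which `e` is affine; so
    -- the straightening is stationary at `x`.
    have hvert := (hcutK.mem_iff hcutout hs₂ hw hs subset_rfl).1 (hwx.symm ▸ hxs₂)
    refine straighten_eq hK hxK (A := (LinearMap.snd ℝ F _).toAffineMap.comp A)
      (fun y hy => ?_) t.2.1 t.2.2
    have hy₂ : y ∈ convexHull ℝ (s₂ : Set E) := convexHull_min hvert (convex_convexHull ℝ _) hy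
    have hy₀ : y ∈ N₀ := hsp₂ ▸ hS₂.mem_space_iff.2 ⟨s₂, hs₂, hy₂⟩
    rw [hg', extendZero_of_mem _ (hsub hy₀)]
    change _ = (A y).2
    rw [← hA y hy₂, extendZero_of_mem _ hy₀]
    rfl

end Lifts

end PLLift

/-! ### The theorem -/

theorem mainTheorem1 {E F : Type*}
    [NormedAddCommGroup E] [NormedSpace ℝ E] [FiniteDimensional ℝ E]
    [NormedAddCommGroup F] [NormedSpace ℝ F] [FiniteDimensional ℝ F]
    {N : Set E} {M : Set F}
    (hN : IsCompactPolyhedron N) (hM : IsCompactPolyhedron M)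
    (f : N → M) (hf : IsPL (fun x => (f x : F))) (hnd : IsNondegenerate f) (k : ℕ) :
    (IsTopologicalPrem k f ↔ IsPLPrem k f) ∧
    (∀ e : N → M × EuclideanSpace ℝ (Fin k), Topology.IsEmbedding e → IsLift f e →
      (∃ e' : N → M × EuclideanSpace ℝ (Fin k),
        IsPLEmbedding (fun x => prodIncl (e' x)) ∧ IsotopicThroughLiftsRel f ∅ e e') ∧
      ∀ (N₀ : Set E) (_ : IsCompactPolyhedron N₀) (hsub : N₀ ⊆ N),
        IsPL (fun x : N₀ => prodIncl (e (Set.inclusion hsub x))) →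
        ∃ e' : N → M × EuclideanSpace ℝ (Fin k),
          IsPLEmbedding (fun x => prodIncl (e' x)) ∧ IsotopicThroughLiftsRel f N₀ e e') := by
  -- The absolute statement is the relative one for the empty set, triangulated by the complex
  -- without faces.
  have hempty : ∀ e : N → M × EuclideanSpace ℝ (Fin k), Topology.IsEmbedding e → IsLift f e →
      ∃ e' : N → M × EuclideanSpace ℝ (Fin k),
        IsPLEmbedding (fun x => prodIncl (e' x)) ∧ IsotopicThroughLiftsRel f ∅ e e' :=
    fun e he hlift => PLLift.exists_isotopic_isPLEmbedding hM hf hnd he hlift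
      (Set.empty_subset N) ⟨⊥, ⟨Set.finite_empty, Geometry.SimplicialComplex.space_bot⟩,
        fun s hs => absurd hs (Set.notMem_empty s)⟩
  refine ⟨⟨?_, ?_⟩, fun e he hlift => ⟨hempty e he hlift, fun N₀ _ hsub hPL =>
    PLLift.exists_isotopic_isPLEmbedding hM hf hnd he hlift hsub hPL⟩⟩
  · rintro ⟨g, hg⟩
    obtain ⟨e', he', H, -, -, hH1, hHt, -⟩ := hempty _ hg fun _ => rfl
    refine ⟨fun x => (e' x).2, ?_⟩
    have : (fun x => prodIncl (f x, (e' x).2)) = fun x => prodIncl (e' x) := by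
      funext x
      have h1 : (e' x).1 = f x := by rw [← hH1]; exact (hHt 1).2 x
      rw [← h1]
    rw [this]
    exact he'
  · rintro ⟨g, hg⟩
    exact ⟨g, PLLift.isEmbedding_of_isPLEmbedding hN hg⟩
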